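/- All digraphs are finite and oriented: they have no loops and at most one of the directed edges $(u,v)$, $(v,u)$ for any two vertices $u,v$. A digraph $\vec H$ with $|H|$ vertices is called impartial if there is an $n\ge |H|$ such that all tournaments on $n$ vertices contain the same number of copies of $\vec H$, that is, of (not necessarily induced) subgraphs isomorphic to $\vec H$. It is weakly connected if it is non-empty and its underlying undirected graph is connected. The recursively bridge-mirrored digraphs are those obtained, up to isomorphism, by the following recursive construction: the digraph with one vertex and no edges is recursively bridge-mirrored; and if $\vec T$ is recursively bridge-mirrored and $r$ is any vertex of $\vec T$, then the digraph formed by two disjoint copies of $\vec T$ together with one new directed edge from the copy of $r$ in one of them to the copy of $r$ in the other is recursively bridge-mirrored. Proposition 5.1. Every weakly connected impartial digraph is recursively bridge-mirrored. -/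

import Mathlib

universe u

namespace Digraph

variable {V W : Type*}

/-- A digraph is an oriented graph if it is obtained by choosing one orientation of every edge of a
simple graph: it has no loops and no pair of antiparallel edges. -/
def IsOriented (G : Digraph V) : Prop :=
  ∀ u v : V, G.Adj u v → ¬ G.Adj v u

/-- A tournament has no loops and, for any two distinct vertices `u` and `v`, exactly one of the
edges `(u, v)` and `(v, u)`. -/
def IsTournament (K : Digraph V) : Prop :=
  (∀ v : V, ¬ K.Adj v v) ∧ ∀ u v : V, u ≠ v → (K.Adj u v ↔ ¬ K.Adj v u)

/-- A digraph is weakly connected if its underlying undirected graph is connected (and hence has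
at least one vertex). -/
def WeaklyConnected (G : Digraph V) : Prop :=
  G.toSimpleGraphInclusive.Connected

/-- A (not necessarily induced, not necessarily spanning) subgraph of a digraph: a set of vertices
together with a set of edges between them. -/
@[ext]
structure Subgraph (K : Digraph W) where
  /-- the vertices of the subgraph -/
  verts : Set W
  /-- the edges of the subgraph -/
  Adj : W → W → Prop
  adj_sub : ∀ {u v : W}, Adj u v → K.Adj u v
  left_mem : ∀ {u v : W}, Adj u v → u ∈ verts
  right_mem : ∀ {u v : W}, Adj u v → v ∈ verts

/-- A subgraph, seen as a digraph on its own set of vertices. -/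
def Subgraph.coe {K : Digraph W} (S : K.Subgraph) : Digraph S.verts where
  Adj u v := S.Adj u v

/-- A finite digraph has finitely many subgraphs. -/
instance Subgraph.instFinite [Finite W] (K : Digraph W) : Finite K.Subgraph :=
  Finite.of_injective (β := Set W × (W → W → Prop)) (fun S => (S.verts, S.Adj)) <| by
    intro S S' h
    exact Subgraph.ext (congrArg Prod.fst h) (congrArg Prod.snd h)

/-- The number of (unlabeled) copies of `H` in `K`: the number of subgraphs of `K` that are
isomorphic to `H`. -/
noncomputable def copyCount (H : Digraph V) (K : Digraph W) : ℕ :=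
  Set.ncard {S : K.Subgraph | Nonempty (H.Adj ≃r S.coe.Adj)}

/-- `H` is impartial if for some `n ≥ |H|` all tournaments on `n` vertices contain the same number
of copies of `H`. -/
def IsImpartial [Fintype V] (H : Digraph V) : Prop :=
  ∃ n : ℕ, Fintype.card V ≤ n ∧
    ∀ K K' : Digraph (Fin n), K.IsTournament → K'.IsTournament →
      H.copyCount K = H.copyCount K'

/-- Two disjoint copies of `T`, rooted at `r`, together with one new edge, directed from the root of
the first copy to the root of the second. -/
def mirrorDouble (T : Digraph V) (r : V) : Digraph (V ⊕ V) where
  Adj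
    | Sum.inl u, Sum.inl v => T.Adj u v
    | Sum.inr u, Sum.inr v => T.Adj u v
    | Sum.inl u, Sum.inr v => u = r ∧ v = r
    | Sum.inr _, Sum.inl _ => False

/-- The recursively bridge-mirrored digraphs: the smallest class of digraphs that contains the
one-vertex digraph without edges, is closed under doubling a member at an arbitrary root, and
is closed under isomorphism. -/
inductive RecursivelyBridgeMirrored : {V : Type u} → Digraph V → Prop
  | single : RecursivelyBridgeMirrored (⊥ : Digraph PUnit.{u + 1})
  | double {V : Type u} (T : Digraph V) (r : V) :
      RecursivelyBridgeMirrored T → RecursivelyBridgeMirrored (T.mirrorDouble r)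
  | iso {V W : Type u} (T : Digraph V) (T' : Digraph W) :
      RecursivelyBridgeMirrored T → Nonempty (T.Adj ≃r T'.Adj) → RecursivelyBridgeMirrored T'

end Digraph

/-! Writing `x i j = 1` or `-1` for the two orientations of an edge of a tournament, the number of
copies of `H` is, up to a constant, a polynomial in these signs that is affine in each of them. If
it is constant on signs, it is therefore constant on all skew matrices, so the homomorphism sums of
`H` over a weighted skew kernel are those of the edgeless digraph on the same vertices.

For transitive tournaments this makes `2 ^ e` a divisor of `v!`, where `H` has `v` vertices and `e`
edges. Hence `e < v` and `H` is a tree. Expanding `∏ (1 + x i j)` over its edges yields the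
generating function of its signed subforests, evaluated at the densities of trees. These densities
change sign when the root moves along an edge, and are otherwise algebraically independent, so the
generating function is already trivial as a polynomial in the codes of centred rooted trees.

Give weight `1` to the single vertex, `X` to one other tree and `0` to the rest. Modulo two, the
result shows that the underlying tree of `H` consists of two copies of a tree joined at
corresponding vertices. Modulo four, the edges at which the signs of the two copies differ would
contribute a nonzero term, so the copies agree, and their generating function is trivial again. -/

/-! ### Matula codes -/

namespace RootedCode

/-- The Matula code of the rooted tree whose root has a single child, at which the tree with code
`n` hangs: the `n`-th prime. The code of a rooted tree is the product of the primes `plant y`, where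
`y` runs over the codes of the branches at its root; so `1` is the single vertex, and
`q * plant y` is the tree `q` with one more branch `y` at its root. -/
noncomputable def plant (n : ℕ+) : ℕ+ :=
  ⟨Nat.nth Nat.Prime (n - 1), (Nat.prime_nth_prime _).pos⟩

lemma plant_prime (n : ℕ+) : (plant n : ℕ).Prime := Nat.prime_nth_prime _

lemma plant_injective : Function.Injective plant := by
  intro a b h
  have h_pred : (a : ℕ) - 1 = b - 1 :=
    Nat.nth_injective Nat.infinite_setOfPred_prime (congrArg PNat.val h)
  have ha := a.pos
  have hb := b.pos
  exact PNat.eq (by omega)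

lemma lt_plant (n : ℕ+) : n < plant n := by
  have h : (n : ℕ) - 1 + 2 ≤ plant n := Nat.add_two_le_nth_prime (n - 1)
  have hn := n.pos
  rw [← PNat.coe_lt_coe]
  omega

/-- The code `n` with `plant n = p`, for a prime `p`. -/
noncomputable def index (p : ℕ) : ℕ+ := ⟨Nat.count Nat.Prime p + 1, Nat.succ_pos _⟩

lemma plant_index {p : ℕ} (hp : p.Prime) : (plant (index p) : ℕ) = p := Nat.nth_count hp

lemma index_plant (n : ℕ+) : index (plant n) = n :=
  plant_injective (PNat.eq (plant_index (plant_prime n)))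

lemma plant_dvd_plant {a b : ℕ+} : plant a ∣ plant b ↔ a = b := by
  rw [PNat.dvd_iff, Nat.prime_dvd_prime_iff_eq (plant_prime a) (plant_prime b), PNat.coe_inj,
    plant_injective.eq_iff]

lemma plant_dvd_mul {a b c : ℕ+} : plant a ∣ b * c ↔ plant a ∣ b ∨ plant a ∣ c := by
  simp only [PNat.dvd_iff, PNat.mul_coe, (plant_prime a).dvd_mul]

lemma not_plant_dvd_self (a : ℕ+) : ¬ plant a ∣ a := fun h =>
  absurd (PNat.le_of_dvd h) (not_le.2 (lt_plant a))

lemma eq_mul_plant_of_dvd {a n : ℕ+} (h : plant a ∣ n) : ∃ q, n = q * plant a :=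
  let ⟨q, hq⟩ := h
  ⟨q, by rw [hq, mul_comm]⟩

lemma eq_one_or_eq_mul_plant (n : ℕ+) : n = 1 ∨ ∃ q y, n = q * plant y := by
  refine or_iff_not_imp_left.2 fun h => ?_
  obtain ⟨p, hp, hpn⟩ := PNat.exists_prime_and_dvd h
  have h_plant : plant (index p) = p := PNat.eq (plant_index hp)
  obtain ⟨q, hq⟩ := eq_mul_plant_of_dvd (h_plant ▸ hpn)
  exact ⟨q, index p, hq⟩

lemma lt_mul_plant_left (q y : ℕ+) : q < q * plant y :=
  lt_mul_of_one_lt_right' q ((one_le (a := y)).trans_lt (lt_plant y))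

lemma lt_mul_plant_right (q y : ℕ+) : y < q * plant y :=
  (lt_plant y).trans_le (le_mul_of_one_le_left' one_le)

lemma induction_plant {motive : ℕ+ → Prop} (one : motive 1)
    (mul : ∀ q y, motive q → motive y → motive (q * plant y)) (n : ℕ+) : motive n := by
  induction n using PNat.strongInductionOn with
  | _ n ih =>
    rcases eq_one_or_eq_mul_plant n with rfl | ⟨q, y, rfl⟩
    · exact one
    · exact mul q y (ih q (lt_mul_plant_left q y)) (ih y (lt_mul_plant_right q y))

lemma eq_and_eq_or_exchange {q y q' y' : ℕ+} (h : q * plant y = q' * plant y') :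
    (q = q' ∧ y = y') ∨ (y ≠ y' ∧ ∃ k, q = k * plant y' ∧ q' = k * plant y) := by
  rcases eq_or_ne y y' with rfl | hne
  · exact Or.inl ⟨mul_right_cancel h, rfl⟩
  refine Or.inr ⟨hne, ?_⟩
  have h_dvd : plant y ∣ q' := (plant_dvd_mul.1 (Dvd.intro_left q h)).resolve_right
    fun h' => hne (plant_dvd_plant.1 h')
  obtain ⟨k, rfl⟩ := eq_mul_plant_of_dvd h_dvd
  exact ⟨k, mul_right_cancel (b := plant y) (by rw [h, mul_right_comm]), rfl⟩

lemma mul_plant_left_inj {q y y' : ℕ+} : q * plant y = q * plant y' ↔ y = y' := by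
  rw [mul_left_cancel_iff, plant_injective.eq_iff]

section lift

variable {M : Type*} [CommMonoid M] (L : M → M)

/-- The underlying function of `lift`, extended to all natural numbers. -/
noncomputable def liftAux (n : ℕ) : M :=
  (n.primeFactorsList.attach.map fun p => L (liftAux (index p.1))).prod
termination_by n
decreasing_by
  have h_prime := Nat.prime_of_mem_primeFactorsList p.2
  calc (index p.1 : ℕ) < plant (index p.1) := PNat.coe_lt_coe _ _ |>.2 (lt_plant _)
    _ = p.1 := plant_index h_prime
    _ ≤ n := Nat.le_of_mem_primeFactorsList p.2

lemma liftAux_eq (n : ℕ) :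
    liftAux L n = (n.primeFactorsList.map fun p => L (liftAux L (index p))).prod := by
  rw [liftAux]
  congr 1
  exact List.attach_map_val (f := fun p => L (liftAux L (index p)))

/-- The codes form the free commutative monoid with an endofunction: a function `L` from a
commutative monoid to itself yields the homomorphism that carries `plant` to `L`. -/
noncomputable def lift : ℕ+ →* M where
  toFun n := liftAux L n
  map_one' := by rw [liftAux_eq]; simp
  map_mul' a b := by
    rw [PNat.mul_coe, liftAux_eq L (a * b), liftAux_eq L a, liftAux_eq L b, ← List.prod_append,
      ← List.map_append]
    exact ((Nat.perm_primeFactorsList_mul a.ne_zero b.ne_zero).map _).prod_eq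

lemma lift_plant (n : ℕ+) : lift L (plant n) = L (lift L n) := by
  change liftAux L _ = L (liftAux L n)
  rw [liftAux_eq, Nat.primeFactorsList_prime (plant_prime n)]
  simp [index_plant]

end lift

/-- The number of vertices of the tree with a given code. -/
noncomputable def size (n : ℕ+) : ℕ :=
  (lift (M := Multiplicative ℕ) (fun k => Multiplicative.ofAdd (k.toAdd + 1)) n).toAdd + 1

@[simp] lemma size_one : size 1 = 1 := by simp [size]

@[simp] lemma size_mul_plant (a b : ℕ+) : size (a * plant b) = size a + size b := by
  simp only [size, map_mul, lift_plant, toAdd_mul, toAdd_ofAdd]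
  omega

lemma size_pos (a : ℕ+) : 0 < size a := Nat.succ_pos _

lemma size_eq_one {n : ℕ+} : size n = 1 ↔ n = 1 := by
  refine ⟨fun h => ?_, fun h => by simp [h]⟩
  rcases eq_one_or_eq_mul_plant n with rfl | ⟨q, y, rfl⟩
  · rfl
  · have hq := size_pos q
    have hy := size_pos y
    rw [size_mul_plant] at h
    omega

lemma size_lt_of_plant_dvd {a n : ℕ+} (h : plant a ∣ n) : size a < size n := by
  obtain ⟨q, rfl⟩ := eq_mul_plant_of_dvd h
  rw [size_mul_plant]
  exact Nat.lt_add_of_pos_left (size_pos q)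

/-- A code is rigid if no vertex of the tree has two branches with the same code, which means that
the rooted tree has no automorphism. -/
inductive Rigid : ℕ+ → Prop
  | one : Rigid 1
  | mul {q y : ℕ+} : Rigid q → Rigid y → ¬ plant y ∣ q → Rigid (q * plant y)

lemma Rigid.of_mul_plant {q y : ℕ+} (h : Rigid (q * plant y)) :
    Rigid q ∧ Rigid y ∧ ¬ plant y ∣ q := by
  induction q using PNat.strongInductionOn generalizing y with
  | _ q ih =>
    generalize hn : q * plant y = n at h
    cases h with
    | one => exact absurd (hn ▸ lt_mul_plant_left q y) (not_lt.2 one_le)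
    | @mul q' y' hq' hy' h_ndvd =>
      obtain ⟨rfl, rfl⟩ | ⟨hne, k, rfl, rfl⟩ := eq_and_eq_or_exchange hn
      · exact ⟨hq', hy', h_ndvd⟩
      · obtain ⟨hk, hy, hyk⟩ := ih k (lt_mul_plant_left k y') hq'
        refine ⟨hk.mul hy' fun h => h_ndvd (h.mul_right _), hy, fun h => ?_⟩
        exact (plant_dvd_mul.1 h).elim hyk fun h' => hne (plant_dvd_plant.1 h')

/-! ### Canonical roots -/

/-- The order in which the two sides of an edge compete for the centre of the tree: the larger side
wins, and sides of equal size are compared by their codes. -/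
noncomputable def rank (n : ℕ+) : ℕ ×ₗ ℕ+ := toLex (size n, n)

lemma rank_injective : Function.Injective rank := fun _ _ h => congrArg (fun r => (ofLex r).2) h

lemma rank_lt_rank_iff {a b : ℕ+} :
    rank a < rank b ↔ size a < size b ∨ size a = size b ∧ a < b := Prod.Lex.toLex_lt_toLex

lemma size_le_of_rank_lt {a b : ℕ+} (h : rank a < rank b) : size a ≤ size b :=
  (rank_lt_rank_iff.1 h).elim le_of_lt fun h' => h'.1.le

lemma heavy_unique {q y q' y' : ℕ+} (h : q * plant y = q' * plant y')
    (hy : size q ≤ size y) (hy' : size q' ≤ size y') : q = q' ∧ y = y' := by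
  refine (eq_and_eq_or_exchange h).resolve_right ?_
  rintro ⟨-, k, rfl, rfl⟩
  have hk := size_pos k
  rw [size_mul_plant] at hy hy'
  omega

/-- `StepIn m n` says that moving the root of `n` to a neighbour whose branch outranks the rest of
the tree gives `m`. -/
def StepIn (m n : ℕ+) : Prop :=
  ∃ q y, rank q < rank y ∧ n = q * plant y ∧ m = y * plant q

lemma wellFounded_stepIn : WellFounded StepIn := by
  have acc_of_heavy : ∀ x b, rank b < rank x → Acc StepIn (x * plant b) := by
    intro x
    induction x using PNat.strongInductionOn with
    | _ x ih =>
      refine fun b hb => ⟨_, ?_⟩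
      rintro _ ⟨q, y, h, he, rfl⟩
      obtain ⟨rfl, rfl⟩ | ⟨-, k, rfl, rfl⟩ := eq_and_eq_or_exchange he
      · exact absurd h hb.not_gt
      · exact ih y (lt_mul_plant_right k y) _ h
  refine ⟨fun n => ⟨_, ?_⟩⟩
  rintro _ ⟨q, y, h, -, rfl⟩
  exact acc_of_heavy y q h

/-- `n` is centred if the branches at its root are outranked by the respective rest of the tree. -/
def IsCentred (n : ℕ+) : Prop := ∀ q y, n = q * plant y → rank y < rank q

lemma centroid_induction {motive : ℕ+ → Prop} (centred : ∀ n, IsCentred n → motive n)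
    (balanced : ∀ a, motive (a * plant a))
    (step : ∀ q y, rank q < rank y → motive (y * plant q) → motive (q * plant y)) (n : ℕ+) :
    motive n := by
  induction n using wellFounded_stepIn.induction with
  | _ n ih =>
    by_cases hn : IsCentred n
    · exact centred n hn
    · simp only [IsCentred, not_forall, not_lt] at hn
      obtain ⟨q, y, rfl, h⟩ := hn
      rcases h.lt_or_eq with h | h
      · exact step q y h (ih _ ⟨q, y, h, rfl, rfl⟩)
      · rw [rank_injective h]
        exact balanced y

open Classical in
/-- The canonical form of a rooted tree: the code of the same tree rooted at its centre, with the
sign `(-1)^d` where `d` is the distance from the root to the centre. If the tree consists of two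
equal halves `a`, joined at their roots, then there is no centre, and the form is `a * plant a` with
sign `0`. The sign is that of the density of the tree under moving the root to the centre, as every
edge carries an antisymmetric factor. -/
noncomputable def canonicalForm (n : ℕ+) : ℤ × ℕ+ :=
  if h : ∃ r : ℕ+ × ℕ+, rank r.1 < rank r.2 ∧ n = r.1 * plant r.2 then
    (-(canonicalForm (h.choose.2 * plant h.choose.1)).1,
      (canonicalForm (h.choose.2 * plant h.choose.1)).2)
  else if ∃ a, n = a * plant a then (0, n) else (1, n)
termination_by wellFounded_stepIn.wrap n
decreasing_by all_goals exact ⟨_, _, h.choose_spec.1, h.choose_spec.2, rfl⟩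

/-- Negates the sign of a signed code. -/
def negForm (r : ℤ × ℕ+) : ℤ × ℕ+ := (-r.1, r.2)

@[simp] lemma negForm_negForm (r : ℤ × ℕ+) : negForm (negForm r) = r := by simp [negForm]

lemma canonicalForm_of_rank_lt {q y : ℕ+} (h : rank q < rank y) :
    canonicalForm (q * plant y) = negForm (canonicalForm (y * plant q)) := by
  have hex : ∃ r : ℕ+ × ℕ+, rank r.1 < rank r.2 ∧ q * plant y = r.1 * plant r.2 := ⟨(q, y), h, rfl⟩
  obtain ⟨hq, hy⟩ := heavy_unique hex.choose_spec.2 (size_le_of_rank_lt h)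
    (size_le_of_rank_lt hex.choose_spec.1)
  rw [canonicalForm, dif_pos hex, ← hq, ← hy, negForm]

lemma canonicalForm_mul_plant_self (a : ℕ+) : canonicalForm (a * plant a) = (0, a * plant a) := by
  rw [canonicalForm, dif_neg, if_pos ⟨a, rfl⟩]
  rintro ⟨⟨q, y⟩, h, he⟩
  obtain ⟨rfl, rfl⟩ := heavy_unique he le_rfl (size_le_of_rank_lt h)
  exact h.false

lemma IsCentred.canonicalForm_eq {n : ℕ+} (h : IsCentred n) : canonicalForm n = (1, n) := by
  rw [canonicalForm, dif_neg, if_neg]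
  · rintro ⟨a, ha⟩
    exact (h a a ha).false
  · rintro ⟨⟨q, y⟩, hr, he⟩
    exact hr.not_gt (h q y he)

lemma canonicalForm_one : canonicalForm 1 = (1, 1) := by
  refine IsCentred.canonicalForm_eq fun q y h => ?_
  exact absurd (h ▸ lt_mul_plant_left q y) (not_lt.2 one_le)

lemma canonicalForm_swap (a b : ℕ+) :
    canonicalForm (b * plant a) = negForm (canonicalForm (a * plant b)) := by
  rcases lt_trichotomy (rank a) (rank b) with h | h | h
  · rw [canonicalForm_of_rank_lt h, negForm_negForm]
  · rw [rank_injective h, canonicalForm_mul_plant_self, negForm, neg_zero]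
  · exact canonicalForm_of_rank_lt h

lemma size_canonicalForm (n : ℕ+) : size (canonicalForm n).2 = size n := by
  induction n using centroid_induction with
  | centred n h => rw [h.canonicalForm_eq]
  | balanced a => rw [canonicalForm_mul_plant_self]
  | step q y h ih =>
    rw [canonicalForm_of_rank_lt h, negForm, ih, size_mul_plant, size_mul_plant, add_comm]

lemma canonicalForm_sign (n : ℕ+) :
    (canonicalForm n).1 = 0 ∨ (canonicalForm n).1 = 1 ∨ (canonicalForm n).1 = -1 := by
  induction n using centroid_induction with
  | centred n h => simp [h.canonicalForm_eq]
  | balanced a => simp [canonicalForm_mul_plant_self]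
  | step q y h ih =>
    rw [canonicalForm_of_rank_lt h, negForm]
    rcases ih with ih | ih | ih <;> simp [ih]

lemma canonicalForm_canonicalForm {n : ℕ+} (h0 : (canonicalForm n).1 ≠ 0) :
    canonicalForm (canonicalForm n).2 = (1, (canonicalForm n).2) := by
  induction n using centroid_induction with
  | centred n h => rw [h.canonicalForm_eq, h.canonicalForm_eq]
  | balanced a => simp [canonicalForm_mul_plant_self] at h0
  | step q y h ih =>
    rw [canonicalForm_of_rank_lt h] at h0 ⊢
    exact ih (neg_ne_zero.1 h0)

/-- Rerooting: `n` is obtained from `m` by moving the root along edges. -/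
inductive Reroot : ℕ+ → ℕ+ → Prop
  | refl (n : ℕ+) : Reroot n n
  | step (a b n : ℕ+) : Reroot (b * plant a) n → Reroot (a * plant b) n

lemma Reroot.size_eq {m n : ℕ+} (h : Reroot m n) : size m = size n := by
  induction h with
  | refl => rfl
  | step a b n _ ih => rw [← ih, size_mul_plant, size_mul_plant, add_comm]

lemma exists_reroot_of_sign_eq_zero {n : ℕ+} (h0 : (canonicalForm n).1 = 0) :
    ∃ a, Reroot n (a * plant a) ∧ (Rigid a → Rigid n) := by
  induction n using centroid_induction with
  | centred n h => simp [h.canonicalForm_eq] at h0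
  | balanced a => exact ⟨a, .refl _, fun ha => ha.mul ha (not_plant_dvd_self a)⟩
  | step q y h ih =>
    rw [canonicalForm_of_rank_lt h] at h0
    obtain ⟨a, ha, h_rigid⟩ := ih (neg_eq_zero.1 h0)
    refine ⟨a, .step _ _ _ ha, fun h_a => ?_⟩
    obtain ⟨hy, hq, -⟩ := (h_rigid h_a).of_mul_plant
    exact hq.mul hy fun hd => (size_lt_of_plant_dvd hd).not_ge (size_le_of_rank_lt h)

/-- Two codes whose canonical forms agree up to sign, where a vanishing sign is
compatible only with a vanishing sign. -/
def SameCanonicalForm (m n : ℕ+) : Prop :=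
  ((canonicalForm m).1 = 0 ∧ (canonicalForm n).1 = 0) ∨
    ((canonicalForm m).1 ≠ 0 ∧ (canonicalForm n).1 ≠ 0 ∧ (canonicalForm m).2 = (canonicalForm n).2)

lemma SameCanonicalForm.swap {a b a' b' : ℕ+}
    (h : SameCanonicalForm (a * plant b) (a' * plant b')) :
    SameCanonicalForm (b * plant a) (b' * plant a') := by
  simpa only [SameCanonicalForm, canonicalForm_swap _ b, canonicalForm_swap _ b', negForm,
    neg_eq_zero, ne_eq] using h

lemma SameCanonicalForm.eq_of_centred {m n : ℕ+} (h : SameCanonicalForm m n) (hm : IsCentred m)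
    (hn : IsCentred n) : m = n := by
  simpa [SameCanonicalForm, hm.canonicalForm_eq, hn.canonicalForm_eq] using h

lemma canonicalForm_of_size_eq {q y : ℕ+} (h : size q = size y) :
    q = y ∧ canonicalForm (q * plant y) = (0, q * plant y) ∨
      q ≠ y ∧ canonicalForm (q * plant y) = (1, q * plant y) ∨
      q ≠ y ∧ canonicalForm (q * plant y) = (-1, y * plant q) := by
  have centred : ∀ {q y}, size q = size y → rank y < rank q → IsCentred (q * plant y) := by
    intro q y h hr q' y' he
    by_contra hle
    obtain ⟨rfl, rfl⟩ := heavy_unique he h.le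
      ((not_lt.1 hle).lt_or_eq.elim size_le_of_rank_lt
        fun e => (congrArg size (rank_injective e)).le)
    exact hle hr
  rcases lt_trichotomy (rank q) (rank y) with hr | hr | hr
  · refine Or.inr (Or.inr ⟨fun e => hr.ne (congrArg rank e), ?_⟩)
    rw [canonicalForm_of_rank_lt hr, (centred h.symm hr).canonicalForm_eq, negForm]
  · obtain rfl := rank_injective hr
    exact Or.inl ⟨rfl, canonicalForm_mul_plant_self _⟩
  · refine Or.inr (Or.inl ⟨fun e => hr.ne' (congrArg rank e), ?_⟩)
    exact (centred h hr).canonicalForm_eq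

lemma branch_unique_of_size_eq {y u v : ℕ+} (hu : size u = size y) (hv : size v = size y)
    (h : SameCanonicalForm (u * plant y) (v * plant y)) : u = v := by
  rcases canonicalForm_of_size_eq hu with ⟨rfl, h_u⟩ | ⟨hne_u, h_u⟩ | ⟨hne_u, h_u⟩ <;>
  rcases canonicalForm_of_size_eq hv with ⟨rfl, h_v⟩ | ⟨hne_v, h_v⟩ | ⟨-, h_v⟩ <;>
  simp only [SameCanonicalForm, h_u, h_v, one_ne_zero, neg_eq_zero, ne_eq, not_true, not_false_iff,
    false_and, and_false, true_and, or_false, false_or, and_self] at h ⊢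
  · exact mul_right_cancel h
  · exact absurd (heavy_unique h hu.le hv.ge).1 hne_u
  · exact absurd (heavy_unique h hu.ge hv.le).1.symm hne_v
  · exact mul_plant_left_inj.1 h

lemma branch_unique {x b b' : ℕ+} (hb : size b < size x) (hs : size b = size b')
    (h : SameCanonicalForm (x * plant b) (x * plant b')) : b = b' := by
  induction x using PNat.strongInductionOn generalizing b b' with
  | _ x ih =>
    -- Any branch with at least half of the vertices is one of `x`.
    by_cases heavy : ∃ k y, x = k * plant y ∧ size (k * plant b) ≤ size y
    · obtain ⟨k, y, rfl, hle⟩ := heavy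
      have hle' : size (k * plant b') = size (k * plant b) := by simp only [size_mul_plant, hs]
      rw [mul_right_comm k _ (plant b), mul_right_comm k _ (plant b')] at h
      apply mul_plant_left_inj (q := k).1
      rcases hle.lt_or_eq with hlt | heq
      · exact ih y (lt_mul_plant_right k y) hlt hle'.symm h.swap
      · exact branch_unique_of_size_eq heq (hle'.trans heq) h
    · have centred : ∀ c, size c = size b → IsCentred (x * plant c) := by
        intro c hc q y he
        rw [rank_lt_rank_iff]
        obtain ⟨rfl, rfl⟩ | ⟨-, k, rfl, rfl⟩ := eq_and_eq_or_exchange he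
        · exact Or.inl (hc ▸ hb)
        · refine Or.inl (lt_of_not_ge fun hle => heavy ⟨k, y, rfl, ?_⟩)
          simpa only [size_mul_plant, hc] using hle
      exact mul_plant_left_inj.1 (h.eq_of_centred (centred b rfl) (centred b' hs.symm))

end RootedCode

open RootedCode

/-! ### Signed trees -/

/-- Rooted trees with signed edges: `att s A B` hangs the root of `B` below the root of `A`. The
sign `1` stands for an edge directed away from the root. -/
inductive SignedTree : Type
  | pt : SignedTree
  | att (s : ℤˣ) (A B : SignedTree) : SignedTree

namespace SignedTree

/-- The code of the underlying rooted tree. -/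
noncomputable def code : SignedTree → ℕ+
  | pt => 1
  | att _ A B => code A * plant (code B)

/-- Isomorphism of rooted signed trees. -/
inductive RootEquiv : SignedTree → SignedTree → Prop
  | refl (A) : RootEquiv A A
  | trans {A B C} : RootEquiv A B → RootEquiv B C → RootEquiv A C
  | comm (s s' A B C) : RootEquiv (att s (att s' A B) C) (att s' (att s A C) B)
  | congr {A A' B B'} (s) : RootEquiv A A' → RootEquiv B B' → RootEquiv (att s A B) (att s A' B')

/-- Isomorphism of unrooted signed trees. -/
inductive TreeEquiv : SignedTree → SignedTree → Prop
  | of_root {A B} : RootEquiv A B → TreeEquiv A B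
  | trans {A B C} : TreeEquiv A B → TreeEquiv B C → TreeEquiv A C
  | swap (s A B) : TreeEquiv (att s A B) (att (-s) B A)

/-- Two signed trees that differ in the signs only. -/
inductive SameShape : SignedTree → SignedTree → Prop
  | pt : SameShape pt pt
  | att {A A' B B'} (s s') : SameShape A A' → SameShape B B' → SameShape (att s A B) (att s' A' B')

lemma SameShape.code_eq {A B : SignedTree} (h : SameShape A B) : A.code = B.code := by
  induction h with
  | pt => rfl
  | att _ _ _ _ ihA ihB => simp only [code, ihA, ihB]

lemma RootEquiv.code_eq {A B : SignedTree} (h : RootEquiv A B) : A.code = B.code := by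
  induction h with
  | refl => rfl
  | trans _ _ ih ih' => exact ih.trans ih'
  | comm => exact mul_right_comm _ _ _
  | congr _ _ _ ihA ihB => simp only [code, ihA, ihB]

lemma eq_pt_of_code_eq_one {t : SignedTree} (h : t.code = 1) : t = pt := by
  cases t with
  | pt => rfl
  | att s A B => exact absurd h (one_le.trans_lt (lt_mul_plant_left A.code B.code)).ne'

lemma exists_rootEquiv_att_of_code_eq {t : SignedTree} {a b : ℕ+} (h : t.code = a * plant b) :
    ∃ s A B, RootEquiv t (att s A B) ∧ A.code = a ∧ B.code = b := by
  induction t generalizing a with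
  | pt => exact absurd h (one_le.trans_lt (lt_mul_plant_left a b)).ne
  | att s A B ihA _ =>
    obtain ⟨hA, hB⟩ | ⟨-, k, hA, rfl⟩ := eq_and_eq_or_exchange h
    · exact ⟨s, A, B, .refl _, hA, hB⟩
    · obtain ⟨s', A', B', he, rfl, rfl⟩ := ihA hA
      exact ⟨s', att s A' B, B', (RootEquiv.congr s he (.refl B)).trans (.comm _ _ _ _ _), rfl, rfl⟩

lemma exists_sameShape_of_code_eq {A B : SignedTree} (h : A.code = B.code) :
    ∃ B', RootEquiv B B' ∧ SameShape A B' := by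
  induction A generalizing B with
  | pt => exact ⟨pt, eq_pt_of_code_eq_one h.symm ▸ .refl _, .pt⟩
  | att s A₁ A₂ ih₁ ih₂ =>
    obtain ⟨s', B₁, B₂, he, h₁, h₂⟩ := exists_rootEquiv_att_of_code_eq h.symm
    obtain ⟨B₁', e₁, f₁⟩ := ih₁ h₁.symm
    obtain ⟨B₂', e₂, f₂⟩ := ih₂ h₂.symm
    exact ⟨att s' B₁' B₂', he.trans (.congr s' e₁ e₂), .att _ _ f₁ f₂⟩

lemma exists_treeEquiv_of_reroot {t : SignedTree} {n : ℕ+} (h : Reroot t.code n) :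
    ∃ t', TreeEquiv t t' ∧ t'.code = n := by
  generalize hm : t.code = m at h
  induction h generalizing t with
  | refl => exact ⟨t, .of_root (.refl _), hm⟩
  | step a b n _ ih =>
    obtain ⟨s, A, B, he, hA, hB⟩ := exists_rootEquiv_att_of_code_eq hm
    obtain ⟨t', h_equiv, h_code⟩ := ih (t := att (-s) B A) (by rw [code, hA, hB])
    exact ⟨t', ((TreeEquiv.of_root he).trans (.swap s A B)).trans h_equiv, h_code⟩

section total

variable {𝔸 R : Type*} [CommRing 𝔸] [CommRing R] [Algebra 𝔸 R] (L : R →ₗ[𝔸] R) (tr : R →ₗ[𝔸] 𝔸)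

/-- The generating function of the rooted subforests of a signed tree. Here `L` plants a tree and
`tr` forgets the root: each edge of the tree is either deleted, which makes the branch below it
a separate component, or kept with its sign. -/
def rooted : SignedTree → R
  | pt => 1
  | att s A B => rooted A * (algebraMap 𝔸 R (tr (rooted B)) + (s : ℤ) • L (rooted B))

/-- The generating function of the subforests of a signed tree. -/
def total (t : SignedTree) : 𝔸 := tr (rooted L tr t)

/-- Moving the root along an edge changes the sign, and a tree that consists of two equal halves
does not contribute. The latter does not follow from the former in characteristic two. -/
structure IsSkew : Prop where
  skew : ∀ g h, tr (g * L h) = - tr (h * L g)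
  alt : ∀ g, tr (g * L g) = 0

variable {L tr}

lemma total_att (s : ℤˣ) (A B : SignedTree) :
    total L tr (att s A B) =
      total L tr A * total L tr B + (s : ℤ) • tr (rooted L tr A * L (rooted L tr B)) := by
  rw [total, rooted, mul_add, map_add, mul_comm, ← Algebra.smul_def, map_smul, mul_smul_comm,
    map_zsmul, smul_eq_mul, mul_comm, total, total]

lemma RootEquiv.rooted_eq {A B : SignedTree} (h : RootEquiv A B) :
    rooted L tr A = rooted L tr B := by
  induction h with
  | refl => rfl
  | trans _ _ ih ih' => exact ih.trans ih'
  | comm => simp only [rooted, mul_right_comm]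
  | congr _ _ _ ihA ihB => simp only [rooted, ihA, ihB]

lemma TreeEquiv.total_eq (hs : IsSkew L tr) {A B : SignedTree} (h : TreeEquiv A B) :
    total L tr A = total L tr B := by
  induction h with
  | of_root h => rw [total, total, h.rooted_eq]
  | trans _ _ ih ih' => exact ih.trans ih'
  | swap s A B => rw [total_att, total_att, hs.skew, mul_comm, Units.val_neg, neg_smul, smul_neg]

lemma total_att_self (hs : IsSkew L tr) (s : ℤˣ) (A : SignedTree) :
    total L tr (att s A A) = total L tr A ^ 2 := by
  rw [total_att, hs.alt, smul_zero, add_zero, sq]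

lemma map_total {𝔸' R' : Type*} [CommRing 𝔸'] [CommRing R'] [Algebra 𝔸' R']
    {L' : R' →ₗ[𝔸'] R'} {tr' : R' →ₗ[𝔸'] 𝔸'} (f : 𝔸 →+* 𝔸') (F : R →+* R')
    (h_algebraMap : ∀ a, F (algebraMap 𝔸 R a) = algebraMap 𝔸' R' (f a))
    (hL : ∀ g, F (L g) = L' (F g)) (htr : ∀ g, f (tr g) = tr' (F g)) (t : SignedTree) :
    f (total L tr t) = total L' tr' t := by
  have h_rooted : F (rooted L tr t) = rooted L' tr' t := by
    induction t with
    | pt => simp [rooted]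
    | att s A B ihA ihB => simp [rooted, h_algebraMap, hL, htr, ihA, ihB]
  rw [total, htr, h_rooted, total]

end total

section formal

variable {𝔸 : Type*} [CommRing 𝔸]

/-- Planting, on formal combinations of codes. -/
noncomputable def formalL (𝔸 : Type*) [CommRing 𝔸] :
    MonoidAlgebra 𝔸 ℕ+ →ₗ[𝔸] MonoidAlgebra 𝔸 ℕ+ :=
  (MonoidAlgebra.coeffLinearEquiv 𝔸).symm.toLinearMap ∘ₗ Finsupp.lmapDomain 𝔸 𝔸 plant ∘ₗ
    (MonoidAlgebra.coeffLinearEquiv 𝔸).toLinearMap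

/-- The linear functional on formal combinations of codes with given values. -/
noncomputable def formalTr (φ : ℕ+ → 𝔸) : MonoidAlgebra 𝔸 ℕ+ →ₗ[𝔸] 𝔸 :=
  Finsupp.linearCombination 𝔸 φ ∘ₗ (MonoidAlgebra.coeffLinearEquiv 𝔸).toLinearMap

@[simp] lemma formalL_single (n : ℕ+) (a : 𝔸) :
    formalL 𝔸 (MonoidAlgebra.single n a) = MonoidAlgebra.single (plant n) a := by
  simp [formalL]

@[simp] lemma formalTr_single (φ : ℕ+ → 𝔸) (n : ℕ+) (a : 𝔸) :
    formalTr φ (MonoidAlgebra.single n a) = a * φ n := by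
  simp [formalTr]

/-- The generating function of the subforests of a signed tree, where a component with code `n` is
weighted by `φ n`. -/
noncomputable def formalTotal (φ : ℕ+ → 𝔸) (t : SignedTree) : 𝔸 :=
  total (formalL 𝔸) (formalTr φ) t

lemma isSkew_formal {φ : ℕ+ → 𝔸} (h_skew : ∀ a b, φ (a * plant b) = -φ (b * plant a))
    (h_alt : ∀ a, φ (a * plant a) = 0) : IsSkew (formalL 𝔸) (formalTr φ) := by
  have skew : ∀ g h, formalTr φ (g * formalL 𝔸 h) = - formalTr φ (h * formalL 𝔸 g) := by
    intro g h
    induction g using MonoidAlgebra.induction_linear with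
    | zero => simp
    | add g g' ih ih' => simp only [add_mul, map_add, mul_add, ih, ih', neg_add]
    | single n a =>
      induction h using MonoidAlgebra.induction_linear with
      | zero => simp
      | add g g' ih ih' => simp only [add_mul, map_add, mul_add, ih, ih', neg_add]
      | single m b => simp [h_skew n m, mul_comm]
  refine ⟨skew, fun g => ?_⟩
  induction g using MonoidAlgebra.induction_linear with
  | zero => simp
  | add g g' ih ih' =>
    simp only [add_mul, map_add, mul_add, ih, ih', skew g g']
    ring
  | single n a => simp [h_alt]

lemma map_formalTotal {𝔹 : Type*} [CommRing 𝔹] (f : 𝔸 →+* 𝔹) (φ : ℕ+ → 𝔸) (t : SignedTree) :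
    f (formalTotal φ t) = formalTotal (fun n => f (φ n)) t := by
  refine map_total f (MonoidAlgebra.mapRingHom ℕ+ f) (fun a => ?_) (fun g => ?_) (fun g => ?_) t
  · simp [MonoidAlgebra.coe_algebraMap]
  · induction g using MonoidAlgebra.induction_linear with
    | zero => simp only [map_zero]
    | add g g' ih ih' => simp only [map_add, ih, ih']
    | single n a => simp
  · induction g using MonoidAlgebra.induction_linear with
    | zero => simp only [map_zero]
    | add g g' ih ih' => simp only [map_add, ih, ih']
    | single n a => simp

lemma formalTotal_eq_total {R : Type*} [CommRing R] [Algebra 𝔸 R] (L : R →ₗ[𝔸] R)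
    (tr : R →ₗ[𝔸] 𝔸) (t : SignedTree) :
    formalTotal (fun n => tr (lift L n)) t = total L tr t := by
  let F : MonoidAlgebra 𝔸 ℕ+ →ₐ[𝔸] R := MonoidAlgebra.lift 𝔸 R ℕ+ (lift L)
  have hL : F.toLinearMap ∘ₗ formalL 𝔸 = L ∘ₗ F.toLinearMap := by
    ext n
    simp [F, lift_plant]
  have htr : formalTr (fun n => tr (lift L n)) = tr ∘ₗ F.toLinearMap := by
    ext n
    simp [F]
  exact map_total (tr := formalTr _) (RingHom.id 𝔸) F.toRingHom F.commutes
    (fun g => LinearMap.congr_fun hL g) (fun g => LinearMap.congr_fun htr g) t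

end formal

end SignedTree

open SignedTree

/-! ### Skew kernels -/

/-- A weighted finite set with an antisymmetric kernel on it. A tournament is the kernel
with the values `1` and `-1` off the diagonal. -/
structure SkewKernel (𝔹 : Type*) [CommRing 𝔹] where
  /-- the points -/
  carrier : Type
  [fintype : Fintype carrier]
  /-- the kernel -/
  val : carrier → carrier → 𝔹
  /-- the weight of a point -/
  weight : carrier → 𝔹
  antisymm : ∀ x y, val x y = - val y x

namespace SkewKernel

attribute [instance] SkewKernel.fintype

variable {𝔹 : Type*} [CommRing 𝔹] (K : SkewKernel 𝔹)

/-- The integral operator of the kernel. -/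
def op : (K.carrier → 𝔹) →ₗ[𝔹] (K.carrier → 𝔹) :=
  Matrix.mulVecLin (Matrix.of fun x y => K.val x y * K.weight y)

/-- Integration against the weight. -/
def integral : (K.carrier → 𝔹) →ₗ[𝔹] 𝔹 := Fintype.linearCombination 𝔹 K.weight

lemma op_apply (g : K.carrier → 𝔹) (x : K.carrier) :
    K.op g x = ∑ y, K.val x y * (K.weight y * g y) := by
  simp [op, Matrix.mulVec, dotProduct, mul_assoc]

lemma integral_apply (g : K.carrier → 𝔹) : K.integral g = ∑ x, K.weight x * g x := by
  simp [integral, Fintype.linearCombination_apply, mul_comm]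

/-- The homomorphism density of a rooted tree, as a function of the image of the root. -/
noncomputable def branch : ℕ+ →* (K.carrier → 𝔹) := lift K.op

/-- The homomorphism density of a rooted tree. -/
noncomputable def density (n : ℕ+) : 𝔹 := K.integral (K.branch n)

lemma branch_plant (n : ℕ+) : K.branch (plant n) = K.op (K.branch n) := lift_plant _ _

lemma integral_mul_op (g h : K.carrier → 𝔹) :
    K.integral (g * K.op h) = - K.integral (h * K.op g) := by
  simp only [integral_apply, op_apply, Pi.mul_apply, Finset.mul_sum, ← Finset.sum_neg_distrib]
  rw [Finset.sum_comm]
  refine Finset.sum_congr rfl fun x _ => Finset.sum_congr rfl fun y _ => ?_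
  rw [K.antisymm y x]
  ring

lemma density_swap (a b : ℕ+) : K.density (a * plant b) = -K.density (b * plant a) := by
  simpa only [density, map_mul, branch_plant] using K.integral_mul_op _ _

end SkewKernel

/-! ### The universal weight -/

lemma eq_sign_mul_of_skew {𝔸 : Type*} [CommRing 𝔸] [NoZeroDivisors 𝔸] [CharZero 𝔸] {φ : ℕ+ → 𝔸}
    (h_skew : ∀ a b, φ (a * plant b) = -φ (b * plant a)) (n : ℕ+) :
    φ n = (canonicalForm n).1 * φ (canonicalForm n).2 := by
  induction n using centroid_induction with
  | centred n h => simp [h.canonicalForm_eq]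
  | balanced a => simpa [canonicalForm_mul_plant_self] using self_eq_neg.1 (h_skew a a)
  | step q y h ih => simp [canonicalForm_of_rank_lt h, h_skew q y, ih, negForm]

/-- The codes of the trees that are rooted at their centre. -/
abbrev Canonical : Type := {c : ℕ+ // canonicalForm c = (1, c)}

/-- The canonical form of `n`, as a variable with a sign. It is the universal weight that is
skew under moving the root. -/
noncomputable def universalWeight (n : ℕ+) : MvPolynomial Canonical ℤ :=
  if h : (canonicalForm n).1 = 0 then 0
  else (canonicalForm n).1 • MvPolynomial.X ⟨(canonicalForm n).2, canonicalForm_canonicalForm h⟩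

lemma aeval_universalWeight {𝔸 : Type*} [CommRing 𝔸] [NoZeroDivisors 𝔸] [CharZero 𝔸] {φ : ℕ+ → 𝔸}
    (h_skew : ∀ a b, φ (a * plant b) = -φ (b * plant a)) (n : ℕ+) :
    MvPolynomial.aeval (fun c : Canonical => φ c) (universalWeight n) = φ n := by
  rw [eq_sign_mul_of_skew h_skew n, universalWeight]
  split_ifs with h
  · simp [h]
  · simp

lemma SkewKernel.aeval_formalTotal {𝔹 : Type*} [CommRing 𝔹] [NoZeroDivisors 𝔹] [CharZero 𝔹]
    (K : SkewKernel 𝔹) (t : SignedTree) :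
    MvPolynomial.aeval (fun c : Canonical => K.density c) (formalTotal universalWeight t) =
      total K.op K.integral t := by
  rw [← formalTotal_eq_total]
  refine (map_formalTotal (MvPolynomial.aeval fun c : Canonical => K.density c).toRingHom
    universalWeight t).trans ?_
  exact congrArg (formalTotal · t) (funext fun n => aeval_universalWeight K.density_swap n)

/-! ### Independence of densities -/

lemma eq_zero_of_eval_eq_zero_on {κ 𝕜 : Type*} [Field 𝕜] [Infinite 𝕜] (Λ : Submodule 𝕜 (κ → 𝕜))
    (p : MvPolynomial κ 𝕜) (hΛ : LinearIndepOn 𝕜 (fun i (v : Λ) => v.1 i) p.vars)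
    (hp : ∀ v ∈ Λ, MvPolynomial.eval v p = 0) : p = 0 := by
  have h_restrict : Λ.map (LinearMap.funLeft 𝕜 𝕜 (Subtype.val : p.vars → κ)) = ⊤ := by
    rw [eq_top_iff, ← span_flip_eq_top_iff_linearIndependent.2 hΛ, Submodule.span_le]
    rintro _ ⟨v, rfl⟩
    exact ⟨v, v.2, rfl⟩
  obtain ⟨q, hq⟩ := MvPolynomial.exists_rename_eq_of_vars_subset_range p
    (Subtype.val : p.vars → κ) Subtype.val_injective (by simp)
  suffices hq0 : q = 0 by rw [← hq, hq0, map_zero]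
  refine MvPolynomial.funext fun y => ?_
  obtain ⟨v, hv, rfl⟩ : y ∈ Λ.map (LinearMap.funLeft 𝕜 𝕜 Subtype.val) := h_restrict ▸ trivial
  have h_eval := hp v hv
  rwa [← hq, MvPolynomial.eval_rename] at h_eval

namespace RootedCode

/-- The number of branches of each type at the root. -/
noncomputable def exponents (n : ℕ+) : ℕ+ →₀ ℕ :=
  (n : ℕ).factorization.comapDomain (fun b => (plant b : ℕ))
    (PNat.coe_injective.comp plant_injective).injOn

lemma exponents_apply (n b : ℕ+) : exponents n b = (n : ℕ).factorization (plant b) := rfl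

lemma exponents_one : exponents 1 = 0 := by
  ext b
  simp [exponents_apply]

lemma exponents_mul_plant (q y : ℕ+) :
    exponents (q * plant y) = exponents q + Finsupp.single y 1 := by
  ext b
  rw [Finsupp.add_apply, exponents_apply, exponents_apply, PNat.mul_coe,
    Nat.factorization_mul q.ne_zero (plant y).ne_zero, (plant_prime y).factorization,
    Finsupp.add_apply, Finsupp.single_apply, Finsupp.single_apply]
  simp only [PNat.coe_inj, plant_injective.eq_iff]

lemma exponents_injective : Function.Injective exponents := by
  refine fun a b h => PNat.eq (Nat.eq_of_factorization_eq a.ne_zero b.ne_zero fun p => ?_)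
  by_cases hp : p.Prime
  · simpa only [exponents_apply, plant_index hp] using DFunLike.congr_fun h (index p)
  · simp only [Nat.factorization_eq_zero_of_not_prime _ hp]

lemma lt_of_mem_support_exponents {n b : ℕ+} (h : b ∈ (exponents n).support) : b < n := by
  rw [Finsupp.mem_support_iff, exponents_apply] at h
  have h_dvd : plant b ∣ n := PNat.dvd_iff.2 (Nat.dvd_of_factorization_pos h)
  exact (lt_plant b).trans_le (PNat.le_of_dvd h_dvd)

lemma map_lift {M M' : Type*} [CommMonoid M] [CommMonoid M'] {L : M → M} {L' : M' → M'}
    (F : M →* M') (h : ∀ g, F (L g) = L' (F g)) (n : ℕ+) : F (lift L n) = lift L' n := by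
  induction n using induction_plant with
  | one => simp only [map_one]
  | mul q y hq hy => simp only [map_mul, lift_plant, hq, h, hy]

end RootedCode

namespace SkewKernel

section operations

variable {𝔹 𝔹' : Type*} [CommRing 𝔹] [CommRing 𝔹'] (K K' : SkewKernel 𝔹)

lemma branch_comp {K K' : SkewKernel 𝔹} (φ : K.carrier → K'.carrier)
    (h : ∀ (g : K'.carrier → 𝔹) x, ∑ y, K'.val (φ x) y * (K'.weight y * g y) =
      ∑ y, K.val x y * (K.weight y * g (φ y))) (n : ℕ+) :
    K'.branch n ∘ φ = K.branch n :=
  map_lift (F := ⟨⟨(· ∘ φ), rfl⟩, fun _ _ => rfl⟩) (L := K'.op) (L' := K.op)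
    (fun g => funext fun x => (K'.op_apply g (φ x)).trans ((h g x).trans (K.op_apply _ x).symm)) n

/-- The disjoint union of two kernels. -/
abbrev sum : SkewKernel 𝔹 where
  carrier := K.carrier ⊕ K'.carrier
  val
    | .inl x, .inl y => K.val x y
    | .inr x, .inr y => K'.val x y
    | _, _ => 0
  weight := Sum.elim K.weight K'.weight
  antisymm
    | .inl x, .inl y => K.antisymm x y
    | .inr x, .inr y => K'.antisymm x y
    | .inl _, .inr _ => neg_zero.symm
    | .inr _, .inl _ => neg_zero.symm

lemma branch_sum (n : ℕ+) : (K.sum K').branch n = Sum.elim (K.branch n) (K'.branch n) :=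
  (Sum.elim_comp_inl_inr _).symm.trans <| congrArg₂ Sum.elim
    (branch_comp (K := K) (K' := K.sum K') Sum.inl (fun g x => by simp) n)
    (branch_comp (K := K') (K' := K.sum K') Sum.inr (fun g x => by simp) n)

/-- The kernel with a new point of weight `a`, from which the other points are seen by `u`. -/
abbrev addPoint (u : K.carrier → 𝔹) (a : 𝔹) : SkewKernel 𝔹 where
  carrier := Option K.carrier
  val
    | some x, some y => K.val x y
    | none, some y => u y
    | some x, none => - u x
    | none, none => 0
  weight := fun x => x.elim a K.weight
  antisymm
    | some x, some y => K.antisymm x y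
    | none, some _ => (neg_neg _).symm
    | some _, none => rfl
    | none, none => neg_zero.symm

lemma branch_addPoint_zero_some (u : K.carrier → 𝔹) (n : ℕ+) :
    (K.addPoint u 0).branch n ∘ some = K.branch n :=
  branch_comp (K := K) (K' := K.addPoint u 0) some (fun g x => by simp) n

lemma branch_addPoint_zero_none (u : K.carrier → 𝔹) (n : ℕ+) :
    (K.addPoint u 0).branch n none =
      MvPolynomial.eval (fun b => K.integral (u * K.branch b))
        (MvPolynomial.monomial (exponents n) 1) := by
  induction n using induction_plant with
  | one => rw [map_one, Pi.one_apply, exponents_one]; simp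
  | mul q y hq _ =>
    rw [exponents_mul_plant, MvPolynomial.monomial_add_single, pow_one,
      map_mul (MvPolynomial.eval _), MvPolynomial.eval_X, map_mul, Pi.mul_apply, hq, branch_plant,
      op_apply, integral_apply, ← K.branch_addPoint_zero_some u y]
    simp [mul_left_comm]

open Classical in
/-- The kernel with a new twin of `z` of weight `-1`, which is balanced by additional weight
at `z`. -/
noncomputable abbrev twin (z : K.carrier) : SkewKernel 𝔹 :=
  { K with weight := K.weight + Pi.single z 1 }.addPoint (K.val z) (-1)

lemma branch_twin {z : K.carrier} (h : K.val z z = 0) (n : ℕ+) :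
    (K.twin z).branch n = K.branch n ∘ (Option.elim · z id) := by
  classical
  refine (branch_comp (K := K.twin z) (K' := K) (Option.elim · z id) (fun g x => ?_) n).symm
  rcases x with _ | x <;>
    simp [add_mul, mul_add, Finset.sum_add_distrib, Pi.single_apply, h, K.antisymm z]

/-- The kernel with coefficients mapped along a ring homomorphism. -/
abbrev map (e : 𝔹 →+* 𝔹') : SkewKernel 𝔹' where
  carrier := K.carrier
  val := fun x y => e (K.val x y)
  weight := fun x => e (K.weight x)
  antisymm := fun x y => by rw [K.antisymm, map_neg]

lemma map_branch (e : 𝔹 →+* 𝔹') (n : ℕ+) : (K.map e).branch n = e ∘ K.branch n :=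
  (map_lift (e.toMonoidHom.compLeft K.carrier) (L' := (K.map e).op)
    (fun g => by ext; simp [op_apply]) n).symm

lemma map_density (e : 𝔹 →+* 𝔹') (n : ℕ+) : (K.map e).density n = e (K.density n) := by
  rw [density, map_branch, integral_apply, density, integral_apply]
  simp

end operations

section independence

variable {𝕜 : Type*} [Field 𝕜]

/-- The vectors of the densities of the branches at a new point of weight `0`. -/
def plantedVectors (𝕜 : Type*) [Field 𝕜] : Submodule 𝕜 (ℕ+ → 𝕜) where
  carrier :=
    {v | ∃ (K : SkewKernel 𝕜) (u : K.carrier → 𝕜), v = fun b => K.integral (u * K.branch b)}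
  zero_mem' := ⟨⟨Empty, nofun, nofun, nofun⟩, nofun, funext fun _ =>
    (Fintype.sum_empty _).symm.trans (integral_apply _ _).symm⟩
  add_mem' := by
    rintro _ _ ⟨K, u, rfl⟩ ⟨K', u', rfl⟩
    refine ⟨K.sum K', Sum.elim u u', funext fun b => ?_⟩
    rw [branch_sum, Pi.add_apply, integral_apply, integral_apply, integral_apply]
    simp
  smul_mem' := by
    rintro a _ ⟨K, u, rfl⟩
    exact ⟨K, a • u, funext fun b => by simp⟩

variable [CharZero 𝕜]

/-- A point of weight `0` in a kernel. -/
abbrev NullPoint (𝕜 : Type*) [Field 𝕜] : Type _ :=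
  Σ K : SkewKernel 𝕜, {z : K.carrier // K.weight z = 0}

lemma branch_mem_plantedVectors (P : NullPoint 𝕜) :
    (fun b => P.1.branch b P.2) ∈ plantedVectors 𝕜 := by
  classical
  obtain ⟨K, z, hz⟩ := P
  refine ⟨K.twin z, Pi.single (some z) 1, funext fun b => ?_⟩
  rw [K.branch_twin (self_eq_neg.1 (K.antisymm z z)), integral_apply]
  simp [Pi.single_apply, hz]

lemma linearIndepOn_branch (N : ℕ) :
    LinearIndepOn 𝕜 (fun n (P : NullPoint 𝕜) => P.1.branch n P.2) {n | (n : ℕ) < N} := by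
  classical
  induction N with
  | zero => simp
  | succ N ih =>
    rw [linearIndepOn_iff]
    intro l hl h_zero
    let monomials (n : ℕ+) : MvPolynomial ℕ+ 𝕜 := MvPolynomial.monomial (exponents n) 1
    have h_indep : LinearIndependent 𝕜 monomials := by
      simpa [Function.comp_def] using
        (MvPolynomial.basisMonomials ℕ+ 𝕜).linearIndependent.comp exponents exponents_injective
    let p := Finsupp.linearCombination 𝕜 monomials l
    have h_vars : (p.vars : Set ℕ+) ⊆ {n | (n : ℕ) < N} := by
      intro b hb
      obtain ⟨n, hn, hb⟩ := Finset.mem_biUnion.1 (MvPolynomial.vars_sum_subset _ _ hb)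
      change b ∈ (l n • MvPolynomial.monomial (exponents n) 1).vars at hb
      rw [MvPolynomial.smul_monomial, smul_eq_mul, mul_one,
        MvPolynomial.vars_monomial (Finsupp.mem_support_iff.1 hn)] at hb
      exact (PNat.coe_lt_coe _ _ |>.2 (lt_of_mem_support_exponents hb)).trans_le
        (Nat.lt_succ_iff.1 (hl hn))
    refine linearIndependent_iff.1 h_indep l <|
      eq_zero_of_eval_eq_zero_on (plantedVectors 𝕜) p ?_ ?_
    · exact (ih.mono h_vars).of_comp (LinearMap.funLeft 𝕜 𝕜 fun P : NullPoint 𝕜 =>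
        (⟨fun b => P.1.branch b P.2, branch_mem_plantedVectors P⟩ : plantedVectors 𝕜))
    · rintro _ ⟨K, u, rfl⟩
      have h_none : ∑ n ∈ l.support, l n * (K.addPoint u 0).branch n none = 0 := by
        have h_apply := congrFun h_zero ⟨K.addPoint u 0, none, rfl⟩
        rwa [Finsupp.linearCombination_apply, Finsupp.sum, Finset.sum_apply] at h_apply
      rw [← h_none]
      refine (map_sum (MvPolynomial.eval _) _ _).trans (Finset.sum_congr rfl fun n _ => ?_)
      rw [branch_addPoint_zero_none]
      exact MvPolynomial.smul_eval _ _ _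

lemma linearIndependent_branch :
    LinearIndependent 𝕜 (fun n (P : NullPoint 𝕜) => P.1.branch n P.2) := by
  have h_union : (⋃ N : ℕ, {n : ℕ+ | (n : ℕ) < N}) = Set.univ :=
    Set.iUnion_eq_univ_iff.2 fun n => ⟨n + 1, Nat.lt_succ_self _⟩
  rw [← linearIndepOn_univ_iff, ← h_union]
  refine linearIndepOn_iUnion_of_directed (Monotone.directed_le ?_) linearIndepOn_branch
  exact fun N N' hN n hn => lt_of_lt_of_le hn hN

end independence

end SkewKernel

namespace SignedTree

lemma exists_code_eq (n : ℕ+) : ∃ t : SignedTree, t.code = n := by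
  induction n using induction_plant with
  | one => exact ⟨.pt, rfl⟩
  | mul q y hq hy =>
    obtain ⟨A, rfl⟩ := hq
    obtain ⟨B, rfl⟩ := hy
    exact ⟨.att 1 A B, rfl⟩

/-- The codes of the tree `t`, with an additional branch of code `g` at its root, rerooted at the
vertices of `t`. The sign is the parity of the distance to the old root. -/
noncomputable def reroots : SignedTree → ℕ+ → (ℕ+ →₀ ℚ)
  | pt, g => Finsupp.single g 1
  | att _ A B, g => reroots A (g * plant B.code) - reroots B (plant (g * A.code))

lemma mul_plant_mul_code (s : ℤˣ) (A B : SignedTree) (g : ℕ+) :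
    g * plant B.code * A.code = g * (att s A B).code := by
  rw [code, mul_right_comm, mul_assoc]

lemma canonicalForm_plant_mul_code (s : ℤˣ) (A B : SignedTree) (g : ℕ+) :
    canonicalForm (plant (g * A.code) * B.code) =
      negForm (canonicalForm (g * (att s A B).code)) := by
  rw [code, ← mul_assoc, mul_comm (plant _), canonicalForm_swap]

lemma canonicalForm_snd_of_reroots_ne_zero {t : SignedTree} {g n : ℕ+} (h : reroots t g n ≠ 0) :
    (canonicalForm n).2 = (canonicalForm (g * t.code)).2 := by
  induction t generalizing g with
  | pt =>
    obtain rfl : g = n := by simpa [reroots, Finsupp.single_apply] using h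
    rw [code, mul_one]
  | att s A B ihA ihB =>
    by_cases hA : reroots A (g * plant B.code) n = 0
    · have hB : reroots B (plant (g * A.code)) n ≠ 0 := by simpa [reroots, hA] using h
      rw [ihB hB, canonicalForm_plant_mul_code s, negForm]
    · rw [ihA hA, mul_plant_mul_code s]

lemma reroots_mul_sign_nonneg (t : SignedTree) (g n : ℕ+) :
    0 ≤ ((canonicalForm (g * t.code)).1 * (canonicalForm n).1 : ℚ) * reroots t g n := by
  induction t generalizing g with
  | pt =>
    by_cases h : g = n
    · subst h
      simpa [reroots, code] using mul_self_nonneg _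
    · simp [reroots, h]
  | att s A B ihA ihB =>
    have hA := ihA (g * plant B.code)
    have hB := ihB (plant (g * A.code))
    rw [canonicalForm_plant_mul_code s, negForm] at hB
    rw [mul_plant_mul_code s] at hA
    rw [reroots, Finsupp.sub_apply]
    push_cast at hB
    linarith

lemma reroots_self_pos {t : SignedTree} {g : ℕ+} (h : (canonicalForm (g * t.code)).1 ≠ 0) :
    0 < reroots t g (g * t.code) := by
  induction t generalizing g with
  | pt => simp [reroots, code]
  | att s A B ihA _ =>
    have hA := ihA (g := g * plant B.code) (by rwa [mul_plant_mul_code s])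
    have hB := reroots_mul_sign_nonneg B (plant (g * A.code)) (g * (att s A B).code)
    have h_sq : 0 < ((canonicalForm (g * (att s A B).code)).1 : ℚ) ^ 2 := by positivity
    rw [canonicalForm_plant_mul_code s, negForm] at hB
    rw [mul_plant_mul_code s] at hA
    rw [reroots, Finsupp.sub_apply, sub_pos]
    push_cast at hB
    nlinarith

lemma linearIndependent_reroots {T : Canonical → SignedTree} (hT : ∀ c, (T c).code = c) :
    LinearIndependent ℚ (fun c => reroots (T c) 1) := by
  classical
  let coeffs : (ℕ+ →₀ ℚ) →ₗ[ℚ] (Canonical → ℚ) := LinearMap.pi fun c => Finsupp.lapply c.1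
  have h_diag : coeffs ∘ (fun c => reroots (T c) 1) =
      fun c => Pi.single c (reroots (T c) 1 c) := by
    refine funext fun c => funext fun c' => ?_
    rcases eq_or_ne c' c with rfl | hne
    · simp [coeffs]
    · suffices h : reroots (T c) 1 c' = 0 by simpa [coeffs, hne] using h
      by_contra h
      have h_form := canonicalForm_snd_of_reroots_ne_zero h
      rw [one_mul, hT, c.2, c'.2] at h_form
      exact hne (Subtype.ext h_form)
  refine LinearIndependent.of_comp coeffs ?_
  rw [h_diag]
  refine Pi.linearIndependent_single_of_ne_zero fun c => ne_of_gt ?_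
  have h_pos := reroots_self_pos (t := T c) (g := 1)
  rw [one_mul, hT, c.2] at h_pos
  exact h_pos one_ne_zero

end SignedTree

namespace SkewKernel

section derivation

variable {𝔹 : Type*} [CommRing 𝔹] [Algebra ℚ 𝔹] (K : SkewKernel 𝔹) {D : Derivation ℚ 𝔹 𝔹}

lemma sum_branch_mul_derivation (hD : ∀ x y, D (K.val x y) = 0) (t : SignedTree) (g : ℕ+) :
    ∑ x, K.branch g x * D (K.weight x * K.branch t.code x) =
      ∑ x, D (K.weight x) * Finsupp.linearCombination ℚ K.branch (reroots t g) x := by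
  induction t generalizing g with
  | pt => simp [code, reroots, mul_comm]
  | att s A B ihA ihB =>
    have h_op (x : K.carrier) : D (K.op (K.branch B.code) x) =
        ∑ y, K.val x y * D (K.weight y * K.branch B.code y) := by
      rw [op_apply, map_sum]
      exact Finset.sum_congr rfl fun y _ => by
        rw [D.leibniz, hD, smul_zero, add_zero, smul_eq_mul]
    have h_left (x : K.carrier) : K.branch g x * D (K.weight x * K.branch (att s A B).code x) =
        K.branch (g * plant B.code) x * D (K.weight x * K.branch A.code x) +
          ∑ y, K.weight x * K.branch (g * A.code) x *
            (K.val x y * D (K.weight y * K.branch B.code y)) := by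
      rw [← Finset.mul_sum, ← h_op, code, map_mul K.branch, map_mul K.branch, map_mul K.branch,
        Pi.mul_apply, Pi.mul_apply, Pi.mul_apply, branch_plant, ← mul_assoc, D.leibniz, smul_eq_mul,
        smul_eq_mul]
      ring
    have h_right : ∑ x, ∑ y, K.weight x * K.branch (g * A.code) x *
          (K.val x y * D (K.weight y * K.branch B.code y)) =
        - ∑ y, K.branch (plant (g * A.code)) y * D (K.weight y * K.branch B.code y) := by
      rw [Finset.sum_comm, ← Finset.sum_neg_distrib]
      refine Finset.sum_congr rfl fun y _ => ?_
      rw [branch_plant, op_apply, Finset.sum_mul, ← Finset.sum_neg_distrib]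
      refine Finset.sum_congr rfl fun x _ => ?_
      rw [K.antisymm x y]
      ring
    simp_rw [h_left]
    rw [Finset.sum_add_distrib, h_right, ihA, ihB, reroots, map_sub, ← sub_eq_add_neg,
      ← Finset.sum_sub_distrib]
    simp only [Pi.sub_apply, mul_sub]

lemma derivation_density (hD : ∀ x y, D (K.val x y) = 0) (t : SignedTree) :
    D (K.density t.code) =
      ∑ x, D (K.weight x) * Finsupp.linearCombination ℚ K.branch (reroots t 1) x := by
  rw [← K.sum_branch_mul_derivation hD, density, integral_apply, map_sum, map_one]
  simp only [Pi.one_apply, one_mul]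

end derivation

section independence

open Polynomial

open Classical in
/-- The kernel with an indeterminate additional weight at the point `z`. -/
noncomputable abbrev perturb (K : SkewKernel ℚ) (z : K.carrier) : SkewKernel ℚ[X] :=
  { K.map C with weight := fun x => C (K.weight x) + if x = z then X else 0 }

variable (K : SkewKernel ℚ) (z : K.carrier)

lemma derivative_perturb_density (t : SignedTree) :
    derivative ((K.perturb z).density t.code) =
      Finsupp.linearCombination ℚ (K.perturb z).branch (reroots t 1) z := by
  classical
  have h := (K.perturb z).derivation_density (D := derivative') (fun x y => derivative_C) t
  have h_weight (x : K.carrier) :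
      derivative' ((K.perturb z).weight x) = (if x = z then 1 else 0 : ℚ[X]) := by
    change derivative (C (K.weight x) + if x = z then X else 0 : ℚ[X]) = _
    split_ifs <;> simp
  refine h.trans ?_
  simp_rw [h_weight]
  simp

lemma eval_zero_perturb_branch (n : ℕ+) (x : K.carrier) :
    ((K.perturb z).branch n x).eval 0 = K.branch n x := by
  classical
  refine (congrFun ((K.perturb z).map_branch (evalRingHom 0) n) x).symm.trans ?_
  refine congrFun (branch_comp (K := K) (K' := (K.perturb z).map (evalRingHom 0)) id
    (fun g x => ?_) n) x
  simp [apply_ite]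

lemma linearIndependent_density :
    LinearIndependent ℚ (fun (c : Canonical) (K : SkewKernel ℚ) => K.density c) := by
  classical
  choose T hT using exists_code_eq
  have h_reroots : LinearIndependent ℚ (fun c : Canonical =>
      Finsupp.linearCombination ℚ (fun n (P : NullPoint ℚ) => P.1.branch n P.2)
        (reroots (T c) 1)) :=
    (linearIndependent_reroots fun c => hT c).map_injOn _ linearIndependent_branch.injOn
  rw [linearIndependent_iff'] at h_reroots ⊢
  intro s l hl
  refine h_reroots s l (funext fun ⟨K, z, _⟩ => ?_)
  have h_perturb : ∑ c ∈ s, l c • (K.perturb z).density (c : ℕ+) = 0 := by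
    refine Polynomial.funext fun μ => ?_
    rw [eval_finsetSum, eval_zero]
    refine Eq.trans ?_ ((Finset.sum_apply _ _ _).symm.trans
      (congrFun hl ((K.perturb z).map (evalRingHom μ))))
    exact Finset.sum_congr rfl fun c _ => by
      rw [eval_smul, Pi.smul_apply, map_density, coe_evalRingHom]
  have h_derivative := congrArg (fun q => (derivative q).eval 0) h_perturb
  rw [derivative_sum, eval_finsetSum, derivative_zero, eval_zero] at h_derivative
  rw [Finset.sum_apply]
  refine Eq.trans ?_ h_derivative
  refine Finset.sum_congr rfl fun c _ => ?_
  rw [derivative_smul, eval_smul, Pi.smul_apply, ← hT c, derivative_perturb_density, hT]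
  simp only [Finsupp.linearCombination_apply, Finsupp.sum, Finset.sum_apply, Pi.smul_apply,
    eval_finsetSum, eval_smul]
  exact congrArg (l c • ·) (Finset.sum_congr rfl fun n _ => by
    rw [← K.eval_zero_perturb_branch z n z])

/-- The vectors of the densities of kernels. -/
def densityVectors : Submodule ℚ (Canonical → ℚ) where
  carrier := Set.range fun (K : SkewKernel ℚ) (c : Canonical) => K.density c
  zero_mem' := ⟨⟨Empty, nofun, nofun, nofun⟩, funext fun _ =>
    (integral_apply _ _).trans (Fintype.sum_empty _)⟩
  add_mem' := by
    rintro _ _ ⟨K, rfl⟩ ⟨K', rfl⟩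
    refine ⟨K.sum K', funext fun c => ?_⟩
    change (K.sum K').density c = K.density c + K'.density c
    rw [density, density, density, branch_sum, integral_apply, integral_apply,
      integral_apply]
    simp
  smul_mem' := by
    rintro a _ ⟨K, rfl⟩
    rcases eq_or_ne a 0 with rfl | ha
    · rw [zero_smul]
      exact ⟨⟨Empty, nofun, nofun, nofun⟩, funext fun _ =>
        (integral_apply _ _).trans (Fintype.sum_empty _)⟩
    · let K' : SkewKernel ℚ :=
        { K with
          val := fun x y => a⁻¹ * K.val x y
          weight := fun x => a * K.weight x
          antisymm := fun x y => by rw [K.antisymm, mul_neg] }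
      have h_branch (n : ℕ+) : K'.branch n = K.branch n :=
        branch_comp (K := K) (K' := K') id
          (fun g x => Finset.sum_congr rfl fun y _ => by simp [K']; field_simp) n
      refine ⟨K', funext fun c => ?_⟩
      change K'.density c = a * K.density c
      rw [density, density, h_branch, integral_apply, integral_apply, Finset.mul_sum]
      exact Finset.sum_congr rfl fun x _ => mul_assoc _ _ _

end independence

lemma eq_zero_of_aeval_density {p : MvPolynomial Canonical ℤ}
    (hp : ∀ K : SkewKernel ℚ, MvPolynomial.aeval (fun c : Canonical => K.density c) p = 0) :
    p = 0 := by
  have h_map : MvPolynomial.map (Int.castRingHom ℚ) p = 0 := by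
    refine eq_zero_of_eval_eq_zero_on densityVectors _ ?_ ?_
    · refine (LinearIndependent.of_comp (LinearMap.funLeft ℚ ℚ fun K : SkewKernel ℚ =>
        (⟨fun c => K.density c, K, rfl⟩ : densityVectors)) ?_).linearIndepOn _
      exact linearIndependent_density
    · rintro _ ⟨K, rfl⟩
      rw [MvPolynomial.eval_map, ← hp K, MvPolynomial.aeval_def]
      rfl
  exact MvPolynomial.map_injective _ Int.cast_injective (by rw [h_map, map_zero])

end SkewKernel

lemma universalWeight_one_ne_zero : universalWeight 1 ≠ 0 := by
  have h : (canonicalForm 1).1 ≠ 0 := by rw [canonicalForm_one]; exact one_ne_zero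
  rw [universalWeight, dif_neg h]
  exact smul_ne_zero h (MvPolynomial.X_ne_zero _)

lemma formalTotal_universalWeight_eq_pow {t : SignedTree} {m k : ℕ}
    (h : ∀ K : SkewKernel ℚ,
      (∑ x, K.weight x) ^ m * total K.op K.integral t = (∑ x, K.weight x) ^ (m + k)) :
    formalTotal universalWeight t = universalWeight 1 ^ k := by
  have h_zero : universalWeight 1 ^ m * formalTotal universalWeight t -
      universalWeight 1 ^ (m + k) = 0 := by
    refine SkewKernel.eq_zero_of_aeval_density fun K => ?_
    have h_one : K.density 1 = ∑ x, K.weight x := by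
      rw [SkewKernel.density, map_one, SkewKernel.integral_apply]
      simp only [Pi.one_apply, mul_one]
    rw [map_sub, map_mul, map_pow, map_pow, aeval_universalWeight K.density_swap, h_one,
      K.aeval_formalTotal, h, sub_self]
  rw [pow_add, ← mul_sub, mul_eq_zero, sub_eq_zero] at h_zero
  exact h_zero.resolve_left (pow_ne_zero _ universalWeight_one_ne_zero)

namespace SignedTree

open Polynomial

/-! ### Subforests -/

/-- A subforest of a signed tree: the product of the signs of its edges, the code of the component
of the root, and the codes of the other components. -/
structure Subforest where
  /-- the product of the signs of the edges -/
  sign : ℤˣ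
  /-- the code of the component of the root -/
  root : ℕ+
  /-- the codes of the other components -/
  others : Multiset ℕ+

namespace Subforest

/-- The subforest of `att s A B` without the new edge. -/
def cut (r : Subforest × Subforest) : Subforest :=
  ⟨r.1.sign * r.2.sign, r.1.root, r.2.root ::ₘ (r.1.others + r.2.others)⟩

/-- The subforest of `att s A B` with the new edge. -/
noncomputable def keep (s : ℤˣ) (r : Subforest × Subforest) : Subforest :=
  ⟨s * (r.1.sign * r.2.sign), r.1.root * plant r.2.root, r.1.others + r.2.others⟩

/-- All components of a subforest. -/
def components (F : Subforest) : Multiset ℕ+ := F.root ::ₘ F.others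

end Subforest

/-- The spanning subforests of a signed tree. -/
noncomputable def subforests : SignedTree → Multiset Subforest
  | pt => {⟨1, 1, 0⟩}
  | att s A B =>
    (subforests A ×ˢ subforests B).map Subforest.cut +
      (subforests A ×ˢ subforests B).map (Subforest.keep s)

lemma size_code_att (s : ℤˣ) (A B : SignedTree) :
    size (att s A B).code = size A.code + size B.code := by
  rw [code, size_mul_plant]

lemma sum_size_components {t : SignedTree} {F : Subforest} (hF : F ∈ subforests t) :
    (F.components.map size).sum = size t.code := by
  induction t generalizing F with
  | pt => rw [Multiset.mem_singleton.1 hF]; simp [Subforest.components, code]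
  | att s A B ihA ihB =>
    rw [size_code_att]
    obtain h | h := Multiset.mem_add.1 hF <;>
    · obtain ⟨⟨G, G'⟩, hG, rfl⟩ := Multiset.mem_map.1 h
      rw [← ihA (Multiset.mem_product.1 hG).1, ← ihB (Multiset.mem_product.1 hG).2]
      simp only [Subforest.components, Subforest.cut, Subforest.keep, Multiset.map_cons,
        Multiset.map_add, Multiset.sum_cons, Multiset.sum_add, size_mul_plant]
      ring

lemma exists_subforests_eq_cons (t : SignedTree) :
    ∃ s S, subforests t = ⟨s, t.code, 0⟩ ::ₘ S ∧ ∀ F ∈ S, F.others ≠ 0 := by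
  induction t with
  | pt => exact ⟨1, 0, rfl, by simp⟩
  | att s A B ihA ihB =>
    obtain ⟨sA, SA, hA, hA'⟩ := ihA
    obtain ⟨sB, SB, hB, hB'⟩ := ihB
    have h_product : subforests A ×ˢ subforests B = (⟨sA, A.code, 0⟩, ⟨sB, B.code, 0⟩) ::ₘ
        (SB.map (Prod.mk (⟨sA, A.code, 0⟩ : Subforest)) + SA ×ˢ subforests B) := by
      rw [hA, hB, Multiset.cons_product, Multiset.map_cons, Multiset.cons_add]
    refine ⟨s * (sA * sB), (subforests A ×ˢ subforests B).map Subforest.cut +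
      (SB.map (Prod.mk (⟨sA, A.code, 0⟩ : Subforest)) + SA ×ˢ subforests B).map
        (Subforest.keep s), ?_, ?_⟩
    · rw [subforests, ← Multiset.add_cons, h_product, Multiset.map_cons (Subforest.keep s)]
      rfl
    intro F hF
    obtain h_cut | h_keep := Multiset.mem_add.1 hF
    · obtain ⟨r, -, rfl⟩ := Multiset.mem_map.1 h_cut
      exact Multiset.cons_ne_zero
    · obtain ⟨⟨G, G'⟩, hG, rfl⟩ := Multiset.mem_map.1 h_keep
      obtain h_right | h_left := Multiset.mem_add.1 hG
      · obtain ⟨G', hG', ⟨⟩⟩ := Multiset.mem_map.1 h_right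
        exact fun h0 => hB' G' hG' (add_eq_zero.1 h0).2
      · exact fun h0 => hA' G (Multiset.mem_product.1 h_left).1 (add_eq_zero.1 h0).1

lemma size_lt_of_mem_components {t : SignedTree} {F : Subforest} (hF : F ∈ subforests t)
    (h_others : F.others ≠ 0) {n : ℕ+} (hn : n ∈ F.components) : size n < size t.code := by
  obtain ⟨S, hS⟩ := Multiset.exists_cons_of_mem hn
  have hS0 : S ≠ 0 := by
    rintro rfl
    have := congrArg Multiset.card hS
    simp [Subforest.components, h_others] at this
  obtain ⟨m, hm⟩ := Multiset.exists_mem_of_ne_zero hS0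
  have h_sum := sum_size_components hF
  rw [hS, Multiset.map_cons, Multiset.sum_cons] at h_sum
  have := Multiset.single_le_sum (fun x _ => Nat.zero_le x) _ (Multiset.mem_map_of_mem size hm)
  have := size_pos m
  lia

section formal

variable {𝔸 : Type*} [CommRing 𝔸]

lemma sum_map_mul_sum_map {α β : Type*} (S : Multiset α) (T : Multiset β) (f : α → 𝔸) (g : β → 𝔸) :
    (S.map f).sum * (T.map g).sum = ((S ×ˢ T).map fun r => f r.1 * g r.2).sum := by
  induction S using Multiset.induction_on with
  | empty => simp
  | cons a S ih => simp [add_mul, ih, Multiset.sum_map_mul_left]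

lemma rooted_formal_eq_sum (φ : ℕ+ → 𝔸) (t : SignedTree) :
    rooted (formalL 𝔸) (formalTr φ) t = ((subforests t).map fun F =>
      MonoidAlgebra.single F.root (((F.sign : ℤ) : 𝔸) * (F.others.map φ).prod)).sum := by
  induction t with
  | pt => simp [rooted, subforests, MonoidAlgebra.one_def]
  | att s A B ihA ihB =>
    rw [rooted, ihA, ihB, subforests, Multiset.map_add, Multiset.sum_add, mul_add]
    simp only [map_multiset_sum, Multiset.map_map, Multiset.smul_sum, sum_map_mul_sum_map]
    refine congrArg₂ (fun S T => Multiset.sum S + Multiset.sum T)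
      (Multiset.map_congr rfl fun r _ => ?_) (Multiset.map_congr rfl fun r _ => ?_)
    · simp [Subforest.cut, MonoidAlgebra.coe_algebraMap]
      ring_nf
    · simp only [Function.comp_apply, formalL_single, Subforest.keep, mul_smul_comm,
        MonoidAlgebra.single_mul_single, MonoidAlgebra.smul_single]
      simp only [zsmul_eq_mul, Multiset.map_add, Multiset.prod_add, Units.val_mul, Int.cast_mul]
      ring_nf

lemma formalTotal_eq_sum (φ : ℕ+ → 𝔸) (t : SignedTree) :
    formalTotal φ t =
      ((subforests t).map fun F => ((F.sign : ℤ) : 𝔸) * (F.components.map φ).prod).sum := by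
  rw [formalTotal, total, rooted_formal_eq_sum, map_multiset_sum, Multiset.map_map]
  refine congrArg _ (Multiset.map_congr rfl fun F _ => ?_)
  rw [Function.comp_apply, formalTr_single, Subforest.components, Multiset.map_cons,
    Multiset.prod_cons]
  ring

lemma exists_formalTotal_sub_eq {φ ψ : ℕ+ → 𝔸} {t : SignedTree}
    (h : ∀ n, size n < size t.code → φ n = ψ n) :
    ∃ s : ℤˣ, formalTotal φ t - formalTotal ψ t = ((s : ℤ) : 𝔸) * (φ t.code - ψ t.code) := by
  obtain ⟨s, S, hS, h_others⟩ := exists_subforests_eq_cons t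
  refine ⟨s, ?_⟩
  have h_eq : ∀ F ∈ S, ((F.sign : ℤ) : 𝔸) * (F.components.map φ).prod =
      ((F.sign : ℤ) : 𝔸) * (F.components.map ψ).prod := fun F hF => by
    rw [Multiset.map_congr rfl fun n hn => h n <|
      size_lt_of_mem_components (hS ▸ Multiset.mem_cons_of_mem hF) (h_others F hF) hn]
  rw [formalTotal_eq_sum, formalTotal_eq_sum, hS, Multiset.map_cons, Multiset.map_cons,
    Multiset.sum_cons, Multiset.sum_cons, Multiset.map_congr rfl h_eq]
  simp [Subforest.components, mul_sub]

lemma formalTotal_ite_eq_one (t : SignedTree) :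
    formalTotal (fun n => if n = 1 then (1 : 𝔸) else 0) t = 1 := by
  have h_lift : (fun n => if n = 1 then (1 : 𝔸) else 0) =
      fun n => (LinearMap.id : 𝔸 →ₗ[𝔸] 𝔸) (lift (0 : 𝔸 →ₗ[𝔸] 𝔸) n) := by
    funext n
    induction n using induction_plant with
    | one => simp
    | mul q y => simp [lift_plant, (one_le.trans_lt (lt_mul_plant_left q y)).ne', -mul_eq_one]
  rw [h_lift, formalTotal_eq_total, total]
  induction t with
  | pt => rfl
  | att s A B ihA ihB => simp_all [rooted]

end formal

section testWeight

variable (𝔸 : Type*) [CommRing 𝔸] (N : ℕ+)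

/-- The weight of rooted trees that is `1` for the tree with one vertex, `X` for the tree with
code `N ≠ 1`, and `0` for the other trees that are rooted at their centre. -/
noncomputable def testWeight (n : ℕ+) : 𝔸[X] :=
  (if n = 1 then 1 else 0) +
    ((canonicalForm n).1 : 𝔸[X]) * if (canonicalForm n).2 = N then X else 0

/-- The generating function of the subforests of a signed tree for the test weight. -/
noncomputable def testTotal (t : SignedTree) : 𝔸[X] := formalTotal (testWeight 𝔸 N) t

lemma isSkew_testWeight : IsSkew (formalL 𝔸[X]) (formalTr (testWeight 𝔸 N)) := by
  have h_ne (a b : ℕ+) : a * plant b ≠ 1 := (one_le.trans_lt (lt_mul_plant_left a b)).ne'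
  refine isSkew_formal (fun a b => ?_) fun a => ?_
  · rw [testWeight, testWeight, canonicalForm_swap b a, if_neg (h_ne a b), if_neg (h_ne b a)]
    simp only [negForm, zero_add, Int.cast_neg, neg_mul]
    rfl
  · rw [testWeight, if_neg (h_ne a a), canonicalForm_mul_plant_self]
    simp

variable {N}

lemma testTotal_eq_one_of_universal (hN : N ≠ 1) {t : SignedTree} {k : ℕ}
    (h : formalTotal universalWeight t = universalWeight 1 ^ k) : testTotal 𝔸 N t = 1 := by
  let eval : MvPolynomial Canonical ℤ →+* 𝔸[X] := MvPolynomial.eval₂Hom (Int.castRingHom _)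
    fun c => (if c.1 = 1 then 1 else 0) + if c.1 = N then X else 0
  have h_eval (n : ℕ+) : eval (universalWeight n) = testWeight 𝔸 N n := by
    rw [testWeight]
    by_cases h_one : n = 1
    · simp [h_one, universalWeight, canonicalForm_one, eval]
    have h_snd : (canonicalForm n).2 ≠ 1 := fun h => h_one <| size_eq_one.1 <| by
      rw [← size_canonicalForm, h, size_one]
    rw [universalWeight]
    by_cases h_sign : (canonicalForm n).1 = 0
    · simp [h_one, h_sign]
    · rw [dif_neg h_sign, map_zsmul, zsmul_eq_mul]
      simp [eval, h_one, h_snd]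
  have h_one : testWeight 𝔸 N 1 = 1 := by simp [testWeight, canonicalForm_one, hN.symm]
  simpa only [testTotal, map_formalTotal, map_pow, h_eval, h_one, one_pow] using congrArg eval h

lemma testTotal_map {𝔸} [CommRing 𝔸] {𝔹 : Type*} [CommRing 𝔹] (f : 𝔸 →+* 𝔹) (t : SignedTree) :
    (testTotal 𝔸 N t).map f = testTotal 𝔹 N t := by
  rw [testTotal, ← coe_mapRingHom, map_formalTotal]
  refine congrArg (formalTotal · t) (funext fun n => ?_)
  rw [testWeight, testWeight]
  split_ifs <;> simp

variable {𝔸}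

lemma coeff_zero_testTotal (t : SignedTree) : (testTotal 𝔸 N t).coeff 0 = 1 := by
  have h_weight :
      (fun n => constantCoeff (testWeight 𝔸 N n)) = fun n => if n = 1 then 1 else 0 := by
    funext n
    rw [testWeight]
    split_ifs <;> simp
  rw [testTotal, ← constantCoeff_apply, map_formalTotal, h_weight, formalTotal_ite_eq_one]

lemma natDegree_testWeight (n : ℕ+) : (testWeight 𝔸 N n).natDegree * size N ≤ size n := by
  have h_one : (if n = 1 then (1 : 𝔸[X]) else 0).natDegree = 0 := by split_ifs <;> simp
  rw [testWeight]
  by_cases h : (canonicalForm n).2 = N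
  · rw [if_pos h, ← h, size_canonicalForm]
    refine (Nat.mul_le_mul_right _
      (natDegree_add_le_of_degree_le (h_one.trans_le zero_le_one) ?_)).trans (one_mul _).le
    exact natDegree_mul_le.trans (by simpa using natDegree_X_le)
  · simp [if_neg h, h_one]

lemma natDegree_testTotal (t : SignedTree) :
    (testTotal 𝔸 N t).natDegree * size N ≤ size t.code := by
  have h_prod (S : Multiset ℕ+) :
      (S.map (testWeight 𝔸 N)).prod.natDegree * size N ≤ (S.map size).sum := by
    induction S using Multiset.induction_on with
    | empty => simp
    | cons n S ih =>
      simp only [Multiset.map_cons, Multiset.prod_cons, Multiset.sum_cons]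
      refine (Nat.mul_le_mul_right _ natDegree_mul_le).trans ?_
      rw [add_mul]
      exact add_le_add (natDegree_testWeight n) ih
  rw [testTotal, formalTotal_eq_sum, ← Nat.le_div_iff_mul_le (size_pos N)]
  refine Multiset.sum_induction (fun p : 𝔸[X] => p.natDegree ≤ size t.code / size N) _
    (fun p q => natDegree_add_le_of_degree_le) (by simp) ?_
  intro p hp
  obtain ⟨F, hF, rfl⟩ := Multiset.mem_map.1 hp
  rw [Nat.le_div_iff_mul_le (size_pos N), ← sum_size_components hF]
  refine (Nat.mul_le_mul_right _ ?_).trans (h_prod F.components)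
  exact natDegree_mul_le.trans_eq (by rw [natDegree_intCast, zero_add])

lemma exists_testTotal_eq_of_size_le {t : SignedTree} (ht : size t.code ≤ size N) :
    ∃ s : ℤˣ, testTotal 𝔸 N t = 1 + ((s : ℤ) : 𝔸[X]) *
      (((canonicalForm t.code).1 : 𝔸[X]) * if (canonicalForm t.code).2 = N then X else 0) := by
  obtain ⟨s, hs⟩ := exists_formalTotal_sub_eq (φ := testWeight 𝔸 N)
    (ψ := fun n => if n = 1 then 1 else 0) (t := t) fun n hn => by
      have h_ne : (canonicalForm n).2 ≠ N := fun h =>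
        (size_canonicalForm n ▸ h ▸ hn.trans_le ht).false
      rw [testWeight, if_neg h_ne, mul_zero, add_zero]
  refine ⟨s, ?_⟩
  rw [formalTotal_ite_eq_one, testWeight, add_sub_cancel_left] at hs
  rw [testTotal, ← hs, add_sub_cancel]

end testWeight

section modTwo

section total

variable {𝔸 R : Type*} [CommRing 𝔸] [CommRing R] [Algebra 𝔸 R] {L : R →ₗ[𝔸] R} {tr : R →ₗ[𝔸] 𝔸}

lemma SameShape.rooted_eq (h_two : (2 : 𝔸) = 0) {A B : SignedTree} (h : SameShape A B) :
    rooted L tr A = rooted L tr B := by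
  have h_smul (s : ℤˣ) (x : R) : (s : ℤ) • x = x := by
    obtain rfl | rfl := Int.units_eq_one_or s
    · exact one_smul ℤ x
    · have : (2 : 𝔸) • x = 0 := by rw [h_two, zero_smul]
      rw [two_smul] at this
      rw [Units.val_neg, Units.val_one, neg_one_smul, neg_eq_of_add_eq_zero_left this]
  induction h with
  | pt => rfl
  | att s s' _ _ ihA ihB => simp only [rooted, ihA, ihB, h_smul]

lemma total_att_of_code_eq (h_two : (2 : 𝔸) = 0) (hs : IsSkew L tr) (s : ℤˣ) {A B : SignedTree}
    (h : A.code = B.code) : total L tr (att s A B) = total L tr A ^ 2 := by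
  obtain ⟨B', h_equiv, h_shape⟩ := exists_sameShape_of_code_eq h
  rw [← total_att_self hs s, total, total, rooted, rooted, h_equiv.rooted_eq,
    h_shape.rooted_eq h_two]

end total

variable {N : ℕ+}

lemma testTotal_eq_ite_of_size_le {t : SignedTree} (ht : size t.code ≤ size N) :
    testTotal (ZMod 2) N t =
      if (canonicalForm t.code).1 ≠ 0 ∧ (canonicalForm t.code).2 = N then 1 + X else 1 := by
  obtain ⟨s, hs⟩ := exists_testTotal_eq_of_size_le (𝔸 := ZMod 2) ht
  rw [hs]
  obtain h | h | h := canonicalForm_sign t.code <;> obtain rfl | rfl := Int.units_eq_one_or s <;>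
    split_ifs <;> simp_all [CharTwo.neg_eq]

lemma TreeEquiv.size_eq {A B : SignedTree} (h : TreeEquiv A B) : size A.code = size B.code := by
  induction h with
  | of_root h => rw [h.code_eq]
  | trans _ _ ih ih' => exact ih.trans ih'
  | swap s A B => rw [size_code_att, size_code_att, add_comm]

lemma exists_double_of_sign_eq_zero {t : SignedTree} (h : (canonicalForm t.code).1 = 0) :
    ∃ s A B, TreeEquiv t (att s A B) ∧ A.code = B.code ∧ (Rigid A.code → Rigid t.code) ∧
      ∀ N, testTotal (ZMod 2) N t = testTotal (ZMod 2) N A ^ 2 := by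
  obtain ⟨a, h_reroot, h_rigid⟩ := exists_reroot_of_sign_eq_zero h
  obtain ⟨t', h_equiv, h_code⟩ := exists_treeEquiv_of_reroot h_reroot
  obtain ⟨s, A, B, h_att, rfl, hB⟩ := exists_rootEquiv_att_of_code_eq h_code
  have h_equiv' := h_equiv.trans (.of_root h_att)
  refine ⟨s, A, B, h_equiv', hB.symm, h_rigid, fun N => ?_⟩
  rw [testTotal, formalTotal, h_equiv'.total_eq (isSkew_testWeight _ N)]
  exact total_att_of_code_eq CharTwo.two_eq_zero (isSkew_testWeight _ N) s hB.symm

/-- The generating functions for all test weights are trivial modulo two. -/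
def TrivialModTwo (t : SignedTree) : Prop :=
  ∀ N, N ≠ 1 → testTotal (ZMod 2) N t = 1

lemma TrivialModTwo.sign_eq_zero {t : SignedTree} (h : TrivialModTwo t) (ht : t.code ≠ 1) :
    (canonicalForm t.code).1 = 0 := by
  by_contra h_sign
  have hN : (canonicalForm t.code).2 ≠ 1 := fun h_one => ht <| size_eq_one.1 <| by
    rw [← size_canonicalForm, h_one, size_one]
  have h_total := testTotal_eq_ite_of_size_le (t := t) (size_canonicalForm _).ge
  rw [h _ hN, if_pos ⟨h_sign, rfl⟩] at h_total
  exact X_ne_zero (left_eq_add.1 h_total)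

lemma TrivialModTwo.exists_double {t : SignedTree} (h : TrivialModTwo t) (ht : t.code ≠ 1) :
    ∃ s A B, TreeEquiv t (att s A B) ∧ A.code = B.code ∧ TrivialModTwo A ∧
      (Rigid A.code → Rigid t.code) := by
  obtain ⟨s, A, B, h_equiv, h_code, h_rigid, h_sq⟩ :=
    exists_double_of_sign_eq_zero (h.sign_eq_zero ht)
  refine ⟨s, A, B, h_equiv, h_code, fun N hN => ?_, h_rigid⟩
  have h_total : testTotal (ZMod 2) N A ^ 2 = 1 ^ 2 := by rw [← h_sq, h N hN, one_pow]
  exact CharTwo.sq_injective h_total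

lemma TrivialModTwo.rigid {t : SignedTree} (h : TrivialModTwo t) :
    Rigid t.code ∧ ∃ m, size t.code = 2 ^ m := by
  induction hn : size t.code using Nat.strong_induction_on generalizing t with
  | _ n ih =>
    by_cases ht : t.code = 1
    · exact ⟨ht ▸ Rigid.one, 0, by rw [← hn, ht, size_one, pow_zero]⟩
    obtain ⟨s, A, B, h_equiv, h_code, hA, h_rigid⟩ := h.exists_double ht
    have h_size := h_equiv.size_eq
    rw [size_code_att, ← h_code, hn] at h_size
    have := size_pos A.code
    obtain ⟨hA_rigid, m, hm⟩ := ih _ (by lia) hA rfl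
    exact ⟨h_rigid hA_rigid, m + 1, by rw [h_size, hm]; ring⟩

/-- The tree `u`, which does not consist of two equal halves, is what remains when the tree `t` is
halved `j` times. Modulo two, the generating functions of `t` are powers of those of `u`. -/
structure IsCore (t u : SignedTree) (j : ℕ) : Prop where
  size_eq : size t.code = 2 ^ j * size u.code
  sign_ne_zero : (canonicalForm u.code).1 ≠ 0
  eq_or_sign_eq_zero : (j = 0 ∧ u = t) ∨ (j ≠ 0 ∧ (canonicalForm t.code).1 = 0)
  testTotal_eq : ∀ N, testTotal (ZMod 2) N t = testTotal (ZMod 2) N u ^ 2 ^ j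

lemma exists_isCore (t : SignedTree) : ∃ u j, IsCore t u j := by
  induction hn : size t.code using Nat.strong_induction_on generalizing t with
  | _ n ih =>
    by_cases h_sign : (canonicalForm t.code).1 = 0
    · obtain ⟨s, A, B, h_equiv, h_code, -, h_sq⟩ := exists_double_of_sign_eq_zero h_sign
      have h_size := h_equiv.size_eq
      rw [size_code_att, ← h_code] at h_size
      have := size_pos A.code
      obtain ⟨u, j, hu⟩ := ih _ (by lia) A rfl
      refine ⟨u, j + 1, ?_, hu.sign_ne_zero, .inr ⟨j.succ_ne_zero, h_sign⟩, fun N => ?_⟩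
      · rw [h_size, hu.size_eq]
        ring
      · rw [h_sq, hu.testTotal_eq, ← pow_mul, pow_succ]
    · exact ⟨t, 0, by simp, h_sign, .inl ⟨rfl, rfl⟩, by simp⟩

end modTwo

/-! ### Sign changes -/

/-- The two parts into which a signed tree falls when an edge is removed. -/
structure EdgeCut where
  /-- the branch below the edge -/
  branch : SignedTree
  /-- the part with the root -/
  rest : SignedTree

/-- The parts of the first signed tree at the edges where a signed tree of the same shape has the
opposite sign. -/
def signChanges : SignedTree → SignedTree → List EdgeCut
  | att s A₁ A₂, att s' B₁ B₂ =>
    (if s = s' then [] else [⟨A₂, A₁⟩]) ++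
      ((signChanges A₁ B₁).map fun r => ⟨r.branch, att s r.rest A₂⟩) ++
      (signChanges A₂ B₂).map fun r => ⟨r.branch, att s A₁ r.rest⟩
  | _, _ => []

lemma SameShape.eq_of_signChanges_eq_nil {A B : SignedTree} (h : SameShape A B)
    (h_nil : signChanges A B = []) : A = B := by
  induction h with
  | pt => rfl
  | att s s' _ _ ihA ihB =>
    simp only [signChanges, List.append_eq_nil_iff, List.map_eq_nil_iff, ite_eq_left_iff,
      List.cons_ne_nil, imp_false, not_not] at h_nil
    rw [ihA h_nil.1.2, ihB h_nil.2, h_nil.1.1]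

lemma size_of_mem_signChanges {A B : SignedTree} {r : EdgeCut} (h : r ∈ signChanges A B) :
    size r.branch.code + size r.rest.code = size A.code := by
  fun_induction signChanges A B generalizing r with
  | case1 s A₁ A₂ s' B₁ B₂ ih₁ ih₂ =>
    simp only [List.mem_append, List.mem_map] at h
    obtain (h | ⟨r', h, rfl⟩) | ⟨r', h, rfl⟩ := h
    · split_ifs at h
      · simp at h
      · rw [List.mem_singleton.1 h, size_code_att, add_comm]
    · rw [size_code_att, size_code_att, ← ih₁ h, add_assoc]
    · rw [size_code_att, size_code_att, ← ih₂ h, add_left_comm]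
  | case2 => simp at h

lemma size_rest_lt {A B : SignedTree} {r : EdgeCut} (h : r ∈ signChanges A B) :
    size r.rest.code < size A.code := by
  have := size_of_mem_signChanges h
  have := size_pos r.branch.code
  lia

lemma nodup_signChanges {A B : SignedTree} (h : Rigid A.code) :
    ((signChanges A B).map fun r => r.rest.code).Nodup := by
  fun_induction signChanges A B with
  | case2 => simp
  | case1 s A₁ A₂ s' B₁ B₂ ih₁ ih₂ =>
    obtain ⟨h₁, h₂, h_dvd⟩ := h.of_mul_plant
    have nodup₁ := (ih₁ h₁).map fun _ _ => mul_right_cancel (b := plant A₂.code)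
    have nodup₂ := (ih₂ h₂).map fun _ _ he =>
      plant_injective (mul_left_cancel (a := A₁.code) he)
    have h_first (c : ℕ+) (hc : c ∈ (if s = s' then [] else [(⟨A₂, A₁⟩ : EdgeCut)]).map
        fun r => r.rest.code) : c = A₁.code := by
      split_ifs at hc <;> simp_all
    have h_right (q : ℕ+) (hq : q ∈ (signChanges A₂ B₂).map fun r => r.rest.code) :
        ¬ plant A₂.code ∣ A₁.code * plant q := by
      obtain ⟨r, hr, rfl⟩ := List.mem_map.1 hq
      rw [plant_dvd_mul, plant_dvd_plant, not_or]
      exact ⟨h_dvd, fun he => (size_rest_lt hr).ne (he ▸ rfl)⟩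
    rw [List.map_map] at nodup₁ nodup₂
    simp only [List.map_append, List.map_map]
    refine List.nodup_append'.2
      ⟨List.nodup_append'.2 ⟨by split_ifs <;> simp, nodup₁, ?_⟩, nodup₂, ?_⟩
    · intro c hc hc'
      obtain ⟨r, -, rfl⟩ := List.mem_map.1 hc'
      exact h_dvd ⟨r.rest.code, by rw [← h_first _ hc, mul_comm]; rfl⟩
    · intro c hc hc'
      obtain ⟨r, hr, rfl⟩ := List.mem_map.1 hc'
      obtain hc | hc := List.mem_append.1 hc
      · exact (lt_mul_plant_left A₁.code r.rest.code).ne' (h_first _ hc)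
      · obtain ⟨r', -, he⟩ := List.mem_map.1 hc
        exact h_right _ (List.mem_map_of_mem hr) ⟨r'.rest.code, he.symm.trans (mul_comm _ _)⟩

section modFour

variable {𝔸 R : Type*} [CommRing 𝔸] [CommRing R] [Algebra 𝔸 R] (L : R →ₗ[𝔸] R) (tr : R →ₗ[𝔸] 𝔸)

/-- The factor that a branch with generating function `g` contributes when it is attached by an
edge with sign `s`. -/
def graft (s : ℤˣ) : R →ₗ[𝔸] R := Algebra.linearMap 𝔸 R ∘ₗ tr + (s : ℤ) • L

/-- The sum over the sign changes of the difference, modulo two, between the generating functions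
of the forest without the edge and of the tree. -/
def signDefect (A B : SignedTree) : R :=
  ((signChanges A B).map fun r =>
    total L tr r.branch • rooted L tr r.rest - rooted L tr A).sum

variable {L tr}

lemma rooted_att (s : ℤˣ) (A B : SignedTree) :
    rooted L tr (att s A B) = rooted L tr A * graft L tr s (rooted L tr B) := rfl

lemma signDefect_att (s s' : ℤˣ) (A₁ A₂ B₁ B₂ : SignedTree) :
    signDefect L tr (att s A₁ A₂) (att s' B₁ B₂) =
      (if s = s' then 0
        else total L tr A₂ • rooted L tr A₁ - rooted L tr A₁ * graft L tr s (rooted L tr A₂)) +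
      signDefect L tr A₁ B₁ * graft L tr s (rooted L tr A₂) +
      rooted L tr A₁ * graft L tr s (signDefect L tr A₂ B₂) := by
  simp only [signDefect, signChanges, List.map_append, List.sum_append, List.map_map,
    map_list_sum, ← List.sum_map_mul_left, ← List.sum_map_mul_right, Function.comp_def, map_sub,
    map_smul, sub_mul, mul_sub, smul_mul_assoc, mul_smul_comm, rooted_att]
  split_ifs <;> simp

lemma exists_graft_eq (s s' : ℤˣ) : ∃ E : R →ₗ[𝔸] R, graft L tr s' = graft L tr s + (2 : 𝔸) • E ∧
    ∀ A B, rooted L tr A * E (rooted L tr B) = if s = s' then 0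
      else total L tr B • rooted L tr A - rooted L tr A * graft L tr s (rooted L tr B) := by
  obtain rfl | h := eq_or_ne s s'
  · exact ⟨0, by simp⟩
  refine ⟨Algebra.linearMap 𝔸 R ∘ₗ tr - graft L tr s, ?_, fun A B => ?_⟩
  · ext x
    obtain rfl : s' = -s := by rw [← Int.units_ne_iff_eq_neg]; exact h.symm
    simp [graft, two_smul]
  · rw [if_neg h, LinearMap.sub_apply, mul_sub, Algebra.smul_def, mul_comm (algebraMap _ _ _)]
    rfl

lemma SameShape.exists_rooted_eq {A B : SignedTree} (h : SameShape A B) :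
    ∃ z, rooted L tr B = rooted L tr A + (2 : 𝔸) • signDefect L tr A B + (4 : 𝔸) • z := by
  induction h with
  | pt => exact ⟨0, by simp [signDefect, signChanges]⟩
  | @att A₁ B₁ A₂ B₂ s s' _ _ ih₁ ih₂ =>
    obtain ⟨z₁, h₁⟩ := ih₁
    obtain ⟨z₂, h₂⟩ := ih₂
    obtain ⟨E, hE, h_ite⟩ := exists_graft_eq (L := L) (tr := tr) s s'
    have h_graft : graft L tr s' (rooted L tr B₂) = graft L tr s (rooted L tr A₂) +
        2 * E (rooted L tr A₂) + 2 * (graft L tr s (signDefect L tr A₂ B₂) +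
          2 * E (signDefect L tr A₂ B₂)) + 4 * graft L tr s' z₂ := by
      rw [h₂, map_add, map_add, map_smul, map_smul, hE]
      simp only [LinearMap.add_apply, LinearMap.smul_apply]
      simp only [Algebra.smul_def, map_ofNat]
    refine ⟨signDefect L tr A₁ B₁ * (E (rooted L tr A₂) + graft L tr s (signDefect L tr A₂ B₂)) +
      (rooted L tr A₁ + 2 * signDefect L tr A₁ B₁) *
        (E (signDefect L tr A₂ B₂) + graft L tr s' z₂) +
      z₁ * graft L tr s' (rooted L tr B₂), ?_⟩
    rw [rooted_att, rooted_att, h_graft, h₁, signDefect_att, ← h_ite]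
    simp only [Algebra.smul_def, map_ofNat]
    ring

lemma SameShape.exists_total_att_eq (hs : IsSkew L tr) (s : ℤˣ) {A B : SignedTree}
    (h : SameShape A B) : ∃ z, total L tr (.att s A B) = total L tr A ^ 2 +
      2 * ((signChanges A B).map fun r =>
        total L tr r.branch * total L tr (.att s A r.rest) - total L tr A ^ 2).sum + 4 * z := by
  obtain ⟨z, hz⟩ := h.exists_rooted_eq (L := L) (tr := tr)
  refine ⟨tr (rooted L tr A * graft L tr s z), ?_⟩
  rw [← total_att_self hs s]
  simp only [total, rooted_att, hz, signDefect, map_add, map_smul, mul_add, mul_smul_comm,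
    smul_eq_mul, map_list_sum, List.map_map, ← List.sum_map_mul_left, Function.comp_def, map_sub,
    mul_sub]

end modFour

section cores

variable {A Q Q₀ u u₀ : SignedTree} {N : ℕ+} {s : ℤˣ} {j j₀ : ℕ}

lemma exponent_le_of_two_pow_mul_lt {M n a b : ℕ} (ha : 2 ^ a * n < 2 * M)
    (hb : M < 2 ^ b * n) : a ≤ b := by
  by_contra! h
  have := Nat.mul_le_mul_right n (Nat.pow_le_pow_right two_pos h)
  rw [Nat.succ_eq_add_one, pow_succ'] at this
  linarith

lemma IsCore.lt_size (hu : IsCore (att s A Q) u j) : size A.code < 2 ^ j * size u.code := by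
  rw [← hu.size_eq, size_code_att]
  exact Nat.lt_add_of_pos_right (size_pos _)

lemma IsCore.size_lt (hu : IsCore (att s A Q) u j) (hQ : size Q.code < size A.code) :
    2 ^ j * size u.code < 2 * size A.code := by
  rw [← hu.size_eq, size_code_att]
  lia

lemma IsCore.exponent_eq (hu : IsCore (att s A Q) u j) (hu₀ : IsCore (att s A Q₀) u₀ j₀)
    (hQ : size Q.code < size A.code) (hQ₀ : size Q₀.code < size A.code)
    (h_size : size u.code = size u₀.code) : j = j₀ :=
  le_antisymm (exponent_le_of_two_pow_mul_lt (hu.size_lt hQ) (h_size ▸ hu₀.lt_size))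
    (exponent_le_of_two_pow_mul_lt (hu₀.size_lt hQ₀) (h_size ▸ hu.lt_size))

lemma IsCore.size_ne_one (hu : IsCore (att s A Q) u j) (hQ : size Q.code < size A.code) {m : ℕ}
    (hA : size A.code = 2 ^ m) : size u.code ≠ 1 := by
  intro h_one
  have h_lt := hu.lt_size
  have h_gt := hu.size_lt hQ
  rw [h_one, mul_one, hA, Nat.pow_lt_pow_iff_right one_lt_two] at h_lt
  rw [h_one, mul_one, hA, ← pow_succ', Nat.pow_lt_pow_iff_right one_lt_two] at h_gt
  lia

lemma IsCore.code_eq (hu : IsCore (att s A Q) u j) (hu₀ : IsCore (att s A Q₀) u₀ j₀)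
    (hQ : size Q.code < size A.code) (hQ₀ : size Q₀.code < size A.code)
    (h : (canonicalForm u.code).2 = (canonicalForm u₀.code).2) : Q.code = Q₀.code := by
  have h_size : size u.code = size u₀.code := by
    rw [← size_canonicalForm, h, size_canonicalForm]
  obtain rfl := hu.exponent_eq hu₀ hQ hQ₀ h_size
  have h_sum := hu.size_eq.trans (h_size ▸ hu₀.size_eq.symm)
  rw [size_code_att, size_code_att, Nat.add_left_cancel_iff] at h_sum
  refine branch_unique hQ h_sum ?_
  obtain ⟨hj, rfl⟩ | ⟨hj, h_sign⟩ := hu.eq_or_sign_eq_zero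
  · obtain ⟨-, rfl⟩ | ⟨hj', -⟩ := hu₀.eq_or_sign_eq_zero
    · exact .inr ⟨hu.sign_ne_zero, hu₀.sign_ne_zero, h⟩
    · exact absurd hj hj'
  · obtain ⟨hj', -⟩ | ⟨-, h_sign₀⟩ := hu₀.eq_or_sign_eq_zero
    · exact absurd hj' hj
    · exact .inl ⟨h_sign, h_sign₀⟩

lemma IsCore.testTotal_eq_ite {t : SignedTree} (hu : IsCore t u j)
    (hN : size u.code ≤ size N) :
    testTotal (ZMod 2) N t = if (canonicalForm u.code).2 = N then 1 + X ^ 2 ^ j else 1 := by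
  rw [hu.testTotal_eq, testTotal_eq_ite_of_size_le hN]
  simp only [hu.sign_ne_zero, ne_eq, not_false_eq_true, true_and]
  split_ifs
  · rw [add_pow_char_pow, one_pow]
  · rw [one_pow]

end cores

lemma exists_maximal_core (s : ℤˣ) (A : SignedTree) {l : List EdgeCut} (hl : l ≠ []) :
    ∃ r₀ ∈ l, ∃ u₀ k, IsCore (att s A r₀.rest) u₀ k ∧ ∀ r ∈ l, ∃ u j,
      IsCore (att s A r.rest) u j ∧ size u.code ≤ size u₀.code := by
  classical
  choose core exponent h_core using exists_isCore
  obtain ⟨r₀, hr₀, h_max⟩ := l.toFinset.exists_max_image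
    (fun r => size (core (att s A r.rest)).code) (by rwa [List.toFinset_nonempty_iff])
  exact ⟨r₀, List.mem_toFinset.1 hr₀, _, _, h_core _, fun r hr =>
    ⟨_, _, h_core _, h_max r (List.mem_toFinset.2 hr)⟩⟩

lemma coeff_two_pow_eq_ite {p q : (ZMod 2)[X]} {k : ℕ} {P : Prop} [Decidable P]
    (hp₀ : p.coeff 0 = 1) (hp : p.natDegree < 2 ^ k)
    (hq : q = if P then 1 + X ^ 2 ^ k else 1) :
    (p * q - 1).coeff (2 ^ k) = if P then 1 else 0 := by
  have h_coeff : p.coeff (2 ^ k) = 0 := coeff_eq_zero_of_natDegree_lt hp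
  have h_one : (1 : (ZMod 2)[X]).coeff (2 ^ k) = 0 := by
    rw [coeff_one, if_neg (Nat.two_pow_pos k).ne']
  subst hq
  split_ifs
  · rw [coeff_sub, mul_add, mul_one, coeff_add, h_coeff, h_one, coeff_mul_X_pow', if_pos le_rfl,
      Nat.sub_self, hp₀, zero_add, sub_zero]
  · rw [mul_one, coeff_sub, h_coeff, h_one, sub_zero]

lemma natDegree_testTotal_branch_lt {A B u₀ : SignedTree} {N : ℕ+} {s : ℤˣ} {r r₀ : EdgeCut}
    {k : ℕ} (hr : r ∈ signChanges A B) (hu₀ : IsCore (att s A r₀.rest) u₀ k)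
    (hN : size u₀.code = size N) : (testTotal (ZMod 2) N r.branch).natDegree < 2 ^ k := by
  refine Nat.lt_of_mul_lt_mul_right (a := size N) ?_
  have h_lt := hu₀.lt_size
  have := size_of_mem_signChanges hr
  rw [hN] at h_lt
  exact (natDegree_testTotal _).trans_lt (by lia)

-- The witness `N` is the code of a largest core of the trees `att s A r.rest`.
lemma exists_coeff_testTotal_eq_ite [DecidableEq EdgeCut] {A B : SignedTree} (s : ℤˣ) {m : ℕ}
    (h_rigid : Rigid A.code) (h_size : size A.code = 2 ^ m) (h_ne : signChanges A B ≠ []) :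
    ∃ N ≠ 1, ∃ r₀ ∈ signChanges A B, ∃ k, ∀ r ∈ signChanges A B,
      (testTotal (ZMod 2) N r.branch * testTotal (ZMod 2) N (att s A r.rest) - 1).coeff (2 ^ k) =
        if r = r₀ then 1 else 0 := by
  obtain ⟨r₀, hr₀, u₀, k, hu₀, h_max⟩ := exists_maximal_core s A h_ne
  set N := (canonicalForm u₀.code).2 with hN
  have h_sizeN : size u₀.code = size N := (size_canonicalForm _).symm
  refine ⟨N, fun h_one => ?_, r₀, hr₀, k, fun r hr => ?_⟩
  · exact hu₀.size_ne_one (size_rest_lt hr₀) h_size (by rw [h_sizeN, h_one, size_one])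
  refine coeff_two_pow_eq_ite (coeff_zero_testTotal _)
    (natDegree_testTotal_branch_lt hr hu₀ h_sizeN) ?_
  split_ifs with h_eq
  · rw [h_eq, hu₀.testTotal_eq_ite h_sizeN.le, if_pos hN.symm]
  · obtain ⟨u, j, hu, h_le⟩ := h_max r hr
    rw [hu.testTotal_eq_ite (h_le.trans_eq h_sizeN), if_neg fun h => h_eq ?_]
    exact List.inj_on_of_nodup_map (nodup_signChanges h_rigid) hr hr₀
      (hu.code_eq hu₀ (size_rest_lt hr) (size_rest_lt hr₀) h)

lemma signChanges_eq_nil {A B : SignedTree} {s : ℤˣ} {m : ℕ} (h_rigid : Rigid A.code)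
    (h_size : size A.code = 2 ^ m) (h_sum : ∀ N ≠ 1, ((signChanges A B).map fun r =>
      testTotal (ZMod 2) N r.branch * testTotal (ZMod 2) N (att s A r.rest) - 1).sum = 0) :
    signChanges A B = [] := by
  classical
  by_contra h_ne
  obtain ⟨N, hN, r₀, hr₀, k, h_coeff⟩ := exists_coeff_testTotal_eq_ite s h_rigid h_size h_ne
  have h_nodup := (nodup_signChanges (B := B) h_rigid).of_map
  have h := congrArg (lcoeff (ZMod 2) (2 ^ k)) (h_sum N hN)
  rw [← List.sum_toFinset _ h_nodup, map_zero, map_sum] at h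
  simp only [lcoeff_apply] at h
  rw [Finset.sum_congr rfl fun r hr => h_coeff r (List.mem_toFinset.1 hr), Finset.sum_ite_eq',
    if_pos (List.mem_toFinset.2 hr₀)] at h
  exact one_ne_zero h

/-- The trees obtained by repeatedly joining two copies of a tree at corresponding vertices. -/
inductive Mirrored : SignedTree → Prop
  | pt : Mirrored pt
  | double (s A) : Mirrored A → Mirrored (att s A A)
  | of_equiv {A B} : TreeEquiv A B → Mirrored B → Mirrored A

lemma exists_eq_one_add_two_mul {p : ℤ[X]} (hp : p.map (Int.castRingHom (ZMod 2)) = 1) :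
    ∃ q, p = 1 + 2 * q := by
  rw [← Polynomial.map_one (Int.castRingHom (ZMod 2)), ← sub_eq_zero, ← Polynomial.map_sub] at hp
  obtain ⟨q, hq⟩ : C (2 : ℤ) ∣ p - 1 := (C_dvd_iff_dvd_coeff _ _).2 fun i =>
    (ZMod.intCast_zmod_eq_zero_iff_dvd _ 2).1 <| by
      rw [← eq_intCast (Int.castRingHom _), ← coeff_map, hp, coeff_zero]
  exact ⟨q, by rw [← sub_eq_iff_eq_add', hq, C_ofNat]⟩

lemma trivialModTwo_of_testTotal_eq_one {t : SignedTree} (h : ∀ N ≠ 1, testTotal ℤ N t = 1) :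
    TrivialModTwo t := fun N hN => by
  rw [← testTotal_map (Int.castRingHom (ZMod 2)), h N hN, Polynomial.map_one]

lemma sum_signChanges_eq_zero {A B : SignedTree} {s : ℤˣ} {N : ℕ+} (h_shape : SameShape A B)
    (hA : testTotal (ZMod 2) N A = 1) (h : testTotal ℤ N (att s A B) = 1) :
    ((signChanges A B).map fun r =>
      testTotal (ZMod 2) N r.branch * testTotal (ZMod 2) N (att s A r.rest) - 1).sum = 0 := by
  obtain ⟨q, hq⟩ := exists_eq_one_add_two_mul <|
    (testTotal_map (Int.castRingHom (ZMod 2)) A).trans hA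
  obtain ⟨z, hz⟩ : ∃ z, testTotal ℤ N (att s A B) = testTotal ℤ N A ^ 2 +
      2 * ((signChanges A B).map fun r => testTotal ℤ N r.branch * testTotal ℤ N (att s A r.rest) -
        testTotal ℤ N A ^ 2).sum + 4 * z :=
    h_shape.exists_total_att_eq (isSkew_testWeight ℤ N) s
  rw [h, hq] at hz
  have h_two : ((signChanges A B).map fun r => testTotal ℤ N r.branch *
      testTotal ℤ N (att s A r.rest) - (1 + 2 * q) ^ 2).sum = 2 * -(q + q ^ 2 + z) :=
    mul_left_cancel₀ two_ne_zero (by linear_combination -hz)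
  have h_map := congrArg (mapRingHom (Int.castRingHom (ZMod 2))) h_two
  rw [← hq, map_list_sum, map_mul, map_ofNat, CharTwo.two_eq_zero (R := (ZMod 2)[X]), zero_mul,
    List.map_map] at h_map
  simpa only [Function.comp_def, coe_mapRingHom, Polynomial.map_sub, Polynomial.map_mul,
    Polynomial.map_pow, testTotal_map, hA, one_pow] using h_map

lemma exists_treeEquiv_att_self {t : SignedTree} (h : ∀ N ≠ 1, testTotal ℤ N t = 1)
    (ht : t.code ≠ 1) : ∃ s A, TreeEquiv t (att s A A) := by
  obtain ⟨s, A, B, h_equiv, h_code, hA, -⟩ := (trivialModTwo_of_testTotal_eq_one h).exists_double ht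
  obtain ⟨h_rigid, m, hm⟩ := hA.rigid
  obtain ⟨B', hB, h_shape⟩ := exists_sameShape_of_code_eq h_code
  replace h_equiv : TreeEquiv t (att s A B') := h_equiv.trans (.of_root (.congr s (.refl A) hB))
  have h_nil : signChanges A B' = [] := signChanges_eq_nil h_rigid hm fun N hN =>
    sum_signChanges_eq_zero h_shape (hA N hN)
      ((h_equiv.total_eq (isSkew_testWeight ℤ N)).symm.trans (h N hN))
  exact ⟨s, A, by rwa [← h_shape.eq_of_signChanges_eq_nil h_nil] at h_equiv⟩

theorem mirrored_of_testTotal_eq_one {t : SignedTree} (h : ∀ N ≠ 1, testTotal ℤ N t = 1) :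
    Mirrored t := by
  induction hn : size t.code using Nat.strong_induction_on generalizing t with
  | _ n ih =>
    by_cases ht : t.code = 1
    · exact eq_pt_of_code_eq_one ht ▸ .pt
    obtain ⟨s, A, h_equiv⟩ := exists_treeEquiv_att_self h ht
    have h_size := h_equiv.size_eq
    rw [size_code_att] at h_size
    have := size_pos A.code
    refine .of_equiv h_equiv (.double s A (ih _ (by lia) (fun N hN => ?_) rfl))
    have h_sq : testTotal ℤ N A ^ 2 = 1 := by
      rw [← h N hN]
      exact ((h_equiv.total_eq (isSkew_testWeight ℤ N)).trans
        (total_att_self (isSkew_testWeight ℤ N) s A)).symm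
    obtain h_one | h_neg := sq_eq_one_iff.1 h_sq
    · exact h_one
    · have h_coeff := coeff_zero_testTotal (𝔸 := ℤ) (N := N) A
      rw [h_neg, coeff_neg, coeff_one_zero] at h_coeff
      norm_num at h_coeff

end SignedTree

/-! ### Realizations of signed trees -/

section bridges

variable {V V' W W' X : Type*}

/-- Two disjoint digraphs and a new edge between `a` and `b`, which is directed from `a` to `b` if
`s = 1` and from `b` to `a` if `s = -1`. -/
def bridgeJoin (s : ℤˣ) (G : Digraph V) (a : V) (H : Digraph W) (b : W) : Digraph (V ⊕ W) where
  Adj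
    | .inl u, .inl v => G.Adj u v
    | .inr u, .inr v => H.Adj u v
    | .inl u, .inr v => s = 1 ∧ u = a ∧ v = b
    | .inr u, .inl v => s = -1 ∧ v = a ∧ u = b

lemma mirrorDouble_eq_bridgeJoin (T : Digraph V) (r : V) :
    T.mirrorDouble r = bridgeJoin 1 T r T r := by
  ext (u | u) (v | v) <;> simp [Digraph.mirrorDouble, bridgeJoin]

/-- Joins of isomorphic rooted digraphs are isomorphic. -/
def bridgeJoinCongr (s : ℤˣ) {G : Digraph V} {G' : Digraph V'} {H : Digraph W} {H' : Digraph W'}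
    (e : G.Adj ≃r G'.Adj) (f : H.Adj ≃r H'.Adj) {a : V} {a' : V'} {b : W} {b' : W'} (ha : e a = a')
    (hb : f b = b') : (bridgeJoin s G a H b).Adj ≃r (bridgeJoin s G' a' H' b').Adj where
  toEquiv := e.toEquiv.sumCongr f.toEquiv
  map_rel_iff' := by
    subst ha hb
    rintro (u | u) (v | v)
    · exact e.map_rel_iff
    · exact and_congr_right' (and_congr e.injective.eq_iff f.injective.eq_iff)
    · exact and_congr_right' (and_congr e.injective.eq_iff f.injective.eq_iff)
    · exact f.map_rel_iff

/-- Reading the new edge from its other end changes the sign. -/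
def bridgeJoinSwap (s : ℤˣ) (G : Digraph V) (a : V) (H : Digraph W) (b : W) :
    (bridgeJoin s G a H b).Adj ≃r (bridgeJoin (-s) H b G a).Adj where
  toEquiv := Equiv.sumComm V W
  map_rel_iff' := by
    rintro (u | u) (v | v)
    · exact Iff.rfl
    · exact and_congr neg_inj and_comm
    · exact and_congr neg_eq_iff_eq_neg and_comm
    · exact Iff.rfl

/-- Two digraphs may be joined to the same vertex in either order. -/
def bridgeJoinComm (s s' : ℤˣ) (G : Digraph V) (a : V) (H : Digraph W) (b : W) (K : Digraph X)
    (c : X) :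
    (bridgeJoin s (bridgeJoin s' G a H b) (.inl a) K c).Adj ≃r
      (bridgeJoin s' (bridgeJoin s G a K c) (.inl a) H b).Adj where
  toEquiv := (Equiv.sumAssoc V W X).trans
    (((Equiv.refl V).sumCongr (Equiv.sumComm W X)).trans (Equiv.sumAssoc V X W).symm)
  map_rel_iff' := by
    rintro ((u | u) | u) ((v | v) | v) <;> simp [bridgeJoin]

/-- The subdigraph induced on a set of vertices. -/
def inducedDigraph (H : Digraph V) (S : Set V) : Digraph S where
  Adj u v := H.Adj u v

lemma toSimpleGraphInclusive_inducedDigraph (H : Digraph V) (S : Set V) :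
    (inducedDigraph H S).toSimpleGraphInclusive = H.toSimpleGraphInclusive.induce S := by
  ext u v
  simp [Digraph.toSimpleGraphInclusive, inducedDigraph, Subtype.ext_iff]

lemma exists_sign_of_adj {H : Digraph V} (h_oriented : H.IsOriented) {r p : V}
    (h : H.toSimpleGraphInclusive.Adj r p) :
    ∃ s : ℤˣ, (s = 1 ↔ H.Adj r p) ∧ (s = -1 ↔ H.Adj p r) := by
  obtain ⟨-, h | h⟩ := h
  · exact ⟨1, by simpa using h, by simpa using h_oriented _ _ h⟩
  · exact ⟨-1, by simpa using h_oriented _ _ h, by simpa using h⟩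

lemma exists_bridgeJoin_iso {H : Digraph V} (h_oriented : H.IsOriented) {S : Set V} {r p : V}
    (hr : r ∈ S) (hp : p ∈ Sᶜ) (h_adj : H.toSimpleGraphInclusive.Adj r p)
    (h_cross : ∀ u ∈ S, ∀ v ∈ Sᶜ, H.toSimpleGraphInclusive.Adj u v → u = r ∧ v = p) :
    ∃ (s : ℤˣ) (e : (bridgeJoin s (inducedDigraph H S) ⟨r, hr⟩ (inducedDigraph H Sᶜ) ⟨p, hp⟩).Adj
      ≃r H.Adj), e (.inl ⟨r, hr⟩) = r := by
  classical
  obtain ⟨s, h_pos, h_neg⟩ := exists_sign_of_adj h_oriented h_adj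
  have h_ne (u : S) (v : ↥Sᶜ) : (u : V) ≠ v := fun h => v.2 (h ▸ u.2)
  refine ⟨s, ⟨Equiv.Set.sumCompl S, ?_⟩, rfl⟩
  rintro (u | u) (v | v)
  · exact Iff.rfl
  · refine Iff.trans ?_ (and_congr h_pos.symm (and_congr Subtype.ext_iff.symm Subtype.ext_iff.symm))
    refine ⟨fun h => ?_, fun ⟨h, hu, hv⟩ => ?_⟩
    · obtain ⟨hu, hv⟩ := h_cross u u.2 v v.2 ⟨h_ne u v, .inl h⟩
      exact ⟨hu ▸ hv ▸ h, hu, hv⟩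
    · exact (congrArg₂ H.Adj hu hv).mpr h
  · refine Iff.trans ?_ (and_congr h_neg.symm (and_congr Subtype.ext_iff.symm Subtype.ext_iff.symm))
    refine ⟨fun h => ?_, fun ⟨h, hv, hu⟩ => ?_⟩
    · obtain ⟨hv, hu⟩ := h_cross v v.2 u u.2 ⟨h_ne v u, .inr h⟩
      exact ⟨hv ▸ hu ▸ h, hv, hu⟩
    · exact (congrArg₂ H.Adj hu hv).mpr h
  · exact Iff.rfl

end bridges

section trees

variable {V : Type*} {G : SimpleGraph V} {r p : V}

lemma reachable_deleteEdges_or (hG : G.Connected) (r p v : V) :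
    (G.deleteEdges {s(r, p)}).Reachable r v ∨ (G.deleteEdges {s(r, p)}).Reachable p v := by
  have h := (SimpleGraph.reachable_iff_reflTransGen r v).1 (hG.preconnected r v)
  induction h with
  | refl => exact .inl .rfl
  | @tail u w _ h ih =>
    by_cases he : s(u, w) = s(r, p)
    · obtain ⟨-, rfl⟩ | ⟨-, rfl⟩ := Sym2.eq_iff.1 he
      · exact .inr .rfl
      · exact .inl .rfl
    · have h_adj : (G.deleteEdges {s(r, p)}).Reachable u w :=
        (SimpleGraph.deleteEdges_adj.2 ⟨h, he⟩).reachable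
      exact ih.imp (·.trans h_adj) (·.trans h_adj)

lemma isTree_induce_reachable {G' : SimpleGraph V} (hG : G.IsTree) (h_le : G' ≤ G) (q : V) :
    (G.induce {x | G'.Reachable q x}).IsTree := by
  refine ⟨?_, hG.isAcyclic.induce _⟩
  have h_supp : (G'.connectedComponentMk q).supp = {x | G'.Reachable q x} := by
    ext x
    simp [SimpleGraph.reachable_comm]
  rw [← h_supp]
  exact (G'.connectedComponentMk q).connected_toSimpleGraph.mono (SimpleGraph.comap_monotone _ h_le)

lemma exists_cut_of_adj (hG : G.IsTree) (h : G.Adj r p) :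
    ∃ S : Set V, r ∈ S ∧ p ∈ Sᶜ ∧ (G.induce S).IsTree ∧ (G.induce Sᶜ).IsTree ∧
      ∀ u ∈ S, ∀ v ∈ Sᶜ, G.Adj u v → u = r ∧ v = p := by
  set G' := G.deleteEdges {s(r, p)} with hG'
  have h_bridge : ¬ G'.Reachable r p :=
    SimpleGraph.isAcyclic_iff_forall_adj_isBridge.1 hG.isAcyclic h
  have h_compl : {x | G'.Reachable r x}ᶜ = {x | G'.Reachable p x} := by
    ext x
    refine ⟨fun hx => (reachable_deleteEdges_or hG.connected r p x).resolve_left hx,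
      fun hx hx' => ?_⟩
    exact h_bridge (hx'.trans hx.symm)
  have h_le : G' ≤ G := SimpleGraph.deleteEdges_le _
  refine ⟨{x | G'.Reachable r x}, .rfl, h_bridge, isTree_induce_reachable hG h_le r,
    h_compl ▸ isTree_induce_reachable hG h_le p, fun u hu v hv huv => ?_⟩
  by_cases he : s(u, v) = s(r, p)
  · refine (Sym2.eq_iff.1 he).resolve_right ?_
    rintro ⟨rfl, rfl⟩
    exact hv .rfl
  · exact (hv (hu.trans (SimpleGraph.deleteEdges_adj.2 ⟨huv, he⟩).reachable)).elim

end trees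

namespace SignedTree

universe v

/-- The vertices of a signed tree. -/
def Vert : SignedTree → Type v
  | pt => PUnit
  | att _ A B => Vert A ⊕ Vert B

/-- The root of a signed tree. -/
def root : ∀ t : SignedTree, Vert.{v} t
  | pt => PUnit.unit
  | att _ A _ => Sum.inl (root A)

/-- The digraph of a signed tree. -/
def toDigraph : ∀ t : SignedTree, Digraph (Vert.{v} t)
  | pt => ⊥
  | att s A B => bridgeJoin s (toDigraph A) (root A) (toDigraph B) (root B)

lemma RootEquiv.exists_iso {A B : SignedTree} (h : RootEquiv A B) :
    ∃ e : (toDigraph.{v} A).Adj ≃r (toDigraph.{v} B).Adj, e (root A) = root B := by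
  induction h with
  | refl => exact ⟨RelIso.refl _, rfl⟩
  | trans _ _ ih ih' =>
    obtain ⟨e, he⟩ := ih
    obtain ⟨e', he'⟩ := ih'
    exact ⟨e.trans e', by rw [RelIso.trans_apply, he, he']⟩
  | comm s s' A B C => exact ⟨bridgeJoinComm s s' _ (root A) _ (root B) _ (root C), rfl⟩
  | @congr A A' B B' s _ _ ih ih' =>
    obtain ⟨e, he⟩ := ih
    obtain ⟨e', he'⟩ := ih'
    exact ⟨bridgeJoinCongr s e e' he he', congrArg Sum.inl he⟩

lemma TreeEquiv.nonempty_iso {A B : SignedTree} (h : TreeEquiv A B) :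
    Nonempty ((toDigraph.{v} A).Adj ≃r (toDigraph.{v} B).Adj) := by
  induction h with
  | of_root h => exact ⟨h.exists_iso.choose⟩
  | trans _ _ ih ih' => exact ⟨ih.some.trans ih'.some⟩
  | swap s A B => exact ⟨bridgeJoinSwap s _ (root A) _ (root B)⟩

lemma Mirrored.recursivelyBridgeMirrored {t : SignedTree} (h : Mirrored t) :
    (toDigraph.{v} t).RecursivelyBridgeMirrored := by
  induction h with
  | pt => exact .single
  | double s A _ ih =>
    have h_double : (toDigraph.{v} (att 1 A A)).RecursivelyBridgeMirrored := by
      rw [toDigraph, ← mirrorDouble_eq_bridgeJoin]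
      exact .double _ _ ih
    obtain rfl | rfl := Int.units_eq_one_or s
    · exact h_double
    · exact .iso _ _ h_double (TreeEquiv.swap 1 A A).nonempty_iso
  | of_equiv h _ ih => exact .iso _ _ ih ⟨h.nonempty_iso.some.symm⟩

lemma exists_iso_of_isTree {V : Type v} [Finite V] {H : Digraph V} (h_oriented : H.IsOriented)
    (h_tree : H.toSimpleGraphInclusive.IsTree) (r : V) :
    ∃ (t : SignedTree) (e : (toDigraph.{v} t).Adj ≃r H.Adj), e (root t) = r := by
  induction hn : Nat.card V using Nat.strong_induction_on generalizing V with
  | _ n ih =>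
    subst hn
    obtain _ | _ := subsingleton_or_nontrivial V
    · have := uniqueOfSubsingleton r
      refine ⟨pt, ⟨Equiv.ofUnique PUnit V, fun {u v} => ?_⟩, Subsingleton.elim _ _⟩
      exact iff_of_false (fun h => h_oriented _ _ h (by convert h)) id
    · obtain ⟨p, h_adj⟩ := h_tree.connected.preconnected.exists_adj_of_nontrivial r
      obtain ⟨S, hr, hp, hS, hS', h_cross⟩ := exists_cut_of_adj h_tree h_adj
      obtain ⟨A, eA, hA⟩ := ih _ (Finite.card_subtype_lt hp) (H := inducedDigraph H S)
        (fun _ _ => h_oriented _ _) (by rwa [toSimpleGraphInclusive_inducedDigraph]) ⟨r, hr⟩ rfl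
      obtain ⟨B, eB, hB⟩ := ih _ (Finite.card_subtype_lt (not_not_intro hr))
        (H := inducedDigraph H Sᶜ) (fun _ _ => h_oriented _ _)
        (by rwa [toSimpleGraphInclusive_inducedDigraph]) ⟨p, hp⟩ rfl
      obtain ⟨s, e, he⟩ := exists_bridgeJoin_iso h_oriented hr hp h_adj h_cross
      refine ⟨att s A B, (bridgeJoinCongr s eA eB hA hB).trans e, ?_⟩
      exact (congrArg (fun a => e (.inl a)) hA).trans he

end SignedTree

/-! ### Homomorphism sums -/

section homSum

variable {V W X R : Type*} [Fintype V] [Fintype W] [CommRing R]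

open Classical in
/-- The edges of a digraph. -/
noncomputable def arcs (H : Digraph V) : Finset (V × V) := {p | H.Adj p.1 p.2}

/-- The weight of a map from the vertices of a digraph to the points of a kernel `f`: each edge
contributes the value of `1 + f` at its image. -/
noncomputable def arcProd (H : Digraph V) (f : X → X → R) (χ : V → X) : R :=
  ∏ p ∈ arcs H, (1 + f (χ p.1) (χ p.2))

lemma mem_arcs {H : Digraph V} {p : V × V} : p ∈ arcs H ↔ H.Adj p.1 p.2 := by simp [arcs]

lemma arcProd_bot (f : X → X → R) (χ : V → X) : arcProd ⊥ f χ = 1 := by simp [arcProd, arcs]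

lemma arcProd_comp_iso {H : Digraph V} {K : Digraph W} (e : H.Adj ≃r K.Adj) (f : X → X → R)
    (χ : W → X) : arcProd H f (χ ∘ e) = arcProd K f χ := by
  refine Finset.prod_equiv (e.toEquiv.prodCongr e.toEquiv) (fun p => ?_) fun p _ => rfl
  rw [mem_arcs, mem_arcs]
  exact e.map_rel_iff.symm

open Classical in
lemma arcProd_eq_prod_ite (H : Digraph V) (f : X → X → R) (χ : V → X) :
    arcProd H f χ = ∏ u, ∏ v, if H.Adj u v then 1 + f (χ u) (χ v) else 1 := by
  rw [arcProd, arcs, Finset.prod_filter, Fintype.prod_prod_type]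

open Classical in
lemma prod_prod_ite_of_iff {P : V → W → Prop} {c : Prop} [Decidable c] {a : V} {b : W}
    (hP : ∀ u v, P u v ↔ c ∧ u = a ∧ v = b) (F : V → W → R) :
    (∏ u, ∏ v, if P u v then F u v else 1) = if c then F a b else 1 := by
  rw [Fintype.prod_eq_single a fun u hu => Finset.prod_eq_one fun v _ => by simp [hP, hu],
    Fintype.prod_eq_single b fun v hv => by simp [hP, hv]]
  simp [hP]

open Classical in
lemma arcProd_bridgeJoin {f : X → X → R} (hf : ∀ x y, f x y = -f y x) (s : ℤˣ) (G : Digraph V)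
    (a : V) (H : Digraph W) (b : W) (χ : V → X) (χ' : W → X) :
    arcProd (bridgeJoin s G a H b) f (Sum.elim χ χ') =
      arcProd G f χ * arcProd H f χ' * (1 + (s : ℤ) * f (χ a) (χ' b)) := by
  let J := bridgeJoin s G a H b
  have h_left : (∏ u, ∏ v, if J.Adj (.inl u) (.inl v) then 1 + f (χ u) (χ v) else 1) =
      arcProd G f χ := (arcProd_eq_prod_ite G f χ).symm
  have h_right : (∏ u, ∏ v, if J.Adj (.inr u) (.inr v) then 1 + f (χ' u) (χ' v) else 1) =
      arcProd H f χ' := (arcProd_eq_prod_ite H f χ').symm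
  have h_out : (∏ u, ∏ v, if J.Adj (.inl u) (.inr v) then 1 + f (χ u) (χ' v) else 1) =
      if s = 1 then 1 + f (χ a) (χ' b) else 1 :=
    prod_prod_ite_of_iff (a := a) (b := b) (fun _ _ => Iff.rfl) fun u v => 1 + f (χ u) (χ' v)
  have h_in : (∏ v, ∏ u, if J.Adj (.inr v) (.inl u) then 1 + f (χ' v) (χ u) else 1) =
      if s = -1 then 1 + f (χ' b) (χ a) else 1 :=
    Finset.prod_comm.trans <|
      prod_prod_ite_of_iff (a := a) (b := b) (fun _ _ => Iff.rfl) fun u v => 1 + f (χ' v) (χ u)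
  rw [arcProd_eq_prod_ite, Fintype.prod_sum_type]
  simp only [Fintype.prod_sum_type, Finset.prod_mul_distrib, Sum.elim_inl, Sum.elim_inr]
  rw [h_left, h_right, h_out, h_in, hf (χ' b)]
  obtain rfl | rfl := Int.units_eq_one_or s <;> simp <;> ring

variable [DecidableEq V] [DecidableEq W]

/-- The homomorphism sum of a digraph: the sum of the weights of all maps to the points of a
kernel. -/
noncomputable def homSum (K : SkewKernel R) (H : Digraph V) : R :=
  ∑ χ : V → K.carrier, (∏ u, K.weight (χ u)) * arcProd H K.val χ

lemma homSum_congr (K : SkewKernel R) {G : Digraph V} {H : Digraph W} (e : G.Adj ≃r H.Adj) :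
    homSum K G = homSum K H := by
  refine (Fintype.sum_equiv (e.toEquiv.arrowCongr (Equiv.refl _)).symm _ _ fun χ => ?_).symm
  exact congrArg₂ _ (e.toEquiv.prod_comp fun u => K.weight (χ u)).symm (arcProd_comp_iso e _ χ).symm

/-- The homomorphism sum in which a map is also weighted by a function of the image of `r`. -/
noncomputable def rootedHomSum (K : SkewKernel R) (H : Digraph V) (r : V) (g : K.carrier → R) : R :=
  ∑ χ : V → K.carrier, g (χ r) * ((∏ u, K.weight (χ u)) * arcProd H K.val χ)

lemma rootedHomSum_one (K : SkewKernel R) (H : Digraph V) (r : V) :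
    rootedHomSum K H r 1 = homSum K H := by
  simp [rootedHomSum, homSum]

lemma rootedHomSum_bridgeJoin (K : SkewKernel R) (s : ℤˣ) (G : Digraph V) (a : V) (H : Digraph W)
    (b : W) (g : K.carrier → R) :
    rootedHomSum K (bridgeJoin s G a H b) (.inl a) g =
      rootedHomSum K G a
        (g * fun x => rootedHomSum K H b (fun y => 1 + (s : ℤ) * K.val x y)) := by
  refine (Fintype.sum_equiv (Equiv.sumArrowEquivProdArrow V W K.carrier).symm
    (fun χ => g (χ.1 a) * ((∏ u, K.weight (Sum.elim χ.1 χ.2 u)) *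
      arcProd (bridgeJoin s G a H b) K.val (Sum.elim χ.1 χ.2)))
    (fun χ => g (χ (.inl a)) * ((∏ u, K.weight (χ u)) *
      arcProd (bridgeJoin s G a H b) K.val χ)) fun χ => rfl).symm.trans ?_
  rw [Fintype.sum_prod_type]
  refine Finset.sum_congr rfl fun χ _ => ?_
  rw [Pi.mul_apply, rootedHomSum, Finset.mul_sum, Finset.sum_mul]
  refine Finset.sum_congr rfl fun χ' _ => ?_
  rw [arcProd_bridgeJoin K.antisymm, Fintype.prod_sum_type]
  simp only [Sum.elim_inl, Sum.elim_inr]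
  ring

end homSum

namespace SignedTree

universe v

variable {R : Type*} [CommRing R]

instance instFintypeVert : ∀ t : SignedTree, Fintype (Vert.{v} t)
  | pt => inferInstanceAs (Fintype PUnit)
  | att _ A B =>
    have := instFintypeVert A
    have := instFintypeVert B
    inferInstanceAs (Fintype (Vert A ⊕ Vert B))

instance instDecidableEqVert : ∀ t : SignedTree, DecidableEq (Vert.{v} t)
  | pt => inferInstanceAs (DecidableEq PUnit)
  | att _ A B =>
    have := instDecidableEqVert A
    have := instDecidableEqVert B
    inferInstanceAs (DecidableEq (Vert A ⊕ Vert B))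

lemma rootedHomSum_bot (K : SkewKernel R) (g : K.carrier → R) :
    rootedHomSum K (⊥ : Digraph PUnit.{v + 1}) PUnit.unit g = K.integral g := by
  rw [rootedHomSum, K.integral_apply]
  refine Fintype.sum_equiv (Equiv.funUnique PUnit K.carrier) _
    (fun x => K.weight x * g x) fun χ => ?_
  simp [arcProd_bot, mul_comm]

lemma rootedHomSum_toDigraph (K : SkewKernel R) (t : SignedTree) (g : K.carrier → R) :
    rootedHomSum K (toDigraph.{v} t) (root t) g = K.integral (g * rooted K.op K.integral t) := by
  induction t generalizing g with
  | pt => exact (rootedHomSum_bot K g).trans (by rw [rooted, mul_one])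
  | att s A B ihA ihB =>
    have h_branch : (fun x => rootedHomSum K (toDigraph.{v} B) (root B)
        fun y => 1 + (s : ℤ) * K.val x y) =
          algebraMap R (K.carrier → R) (K.integral (rooted K.op K.integral B)) +
            (s : ℤ) • K.op (rooted K.op K.integral B) := by
      funext x
      rw [ihB]
      simp only [Pi.add_apply, Pi.smul_apply, Pi.algebraMap_apply, Algebra.algebraMap_self,
        RingHom.id_apply, K.op_apply, K.integral_apply, Pi.mul_apply]
      simp only [zsmul_eq_mul, Finset.mul_sum, ← Finset.sum_add_distrib]
      exact Finset.sum_congr rfl fun y _ => by ring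
    refine (rootedHomSum_bridgeJoin K s _ (root A) _ (root B) g).trans ?_
    rw [h_branch, ihA, rooted, mul_assoc, mul_comm (rooted _ _ A)]

lemma homSum_toDigraph (K : SkewKernel R) (t : SignedTree) :
    homSum K (toDigraph.{v} t) = total K.op K.integral t := by
  rw [← rootedHomSum_one K _ (root t), rootedHomSum_toDigraph, one_mul, total]

end SignedTree

/-! ### Copies and injective homomorphisms -/

section copies

variable {V W : Type*}

/-- The injective homomorphisms of digraphs. -/
abbrev InjHom (H : Digraph V) (K : Digraph W) : Type _ :=
  {φ : V ↪ W // ∀ u v, H.Adj u v → K.Adj (φ u) (φ v)}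

variable {H : Digraph V} {K : Digraph W}

/-- The image of an injective homomorphism, which is a copy of its source. -/
def InjHom.image (φ : InjHom H K) : K.Subgraph where
  verts := Set.range φ.1
  Adj x y := ∃ u v, H.Adj u v ∧ φ.1 u = x ∧ φ.1 v = y
  adj_sub := by
    rintro _ _ ⟨u, v, h, rfl, rfl⟩
    exact φ.2 u v h
  left_mem := by
    rintro _ _ ⟨u, _, _, rfl, _⟩
    exact ⟨u, rfl⟩
  right_mem := by
    rintro _ _ ⟨_, v, _, _, rfl⟩
    exact ⟨v, rfl⟩

/-- An injective homomorphism is an isomorphism onto its image. -/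
noncomputable def InjHom.isoImage (φ : InjHom H K) : H.Adj ≃r φ.image.coe.Adj where
  toEquiv := Equiv.ofInjective φ.1 φ.1.injective
  map_rel_iff' {a b} := by
    constructor
    · rintro ⟨u, v, h, hu, hv⟩
      rwa [← φ.1.injective hu, ← φ.1.injective hv]
    · exact fun h => ⟨a, b, h, rfl, rfl⟩

/-- The injective homomorphism given by an isomorphism onto a subgraph. -/
def InjHom.ofIso {S : K.Subgraph} (e : H.Adj ≃r S.coe.Adj) : InjHom H K :=
  ⟨e.toEquiv.toEmbedding.trans (.subtype _), fun _ _ h => S.adj_sub (e.map_rel_iff.2 h)⟩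

lemma InjHom.image_ofIso {S : K.Subgraph} (e : H.Adj ≃r S.coe.Adj) : (ofIso e).image = S := by
  ext x y
  · constructor
    · rintro ⟨u, rfl⟩
      exact (e u).2
    · intro hx
      obtain ⟨u, hu⟩ := e.surjective ⟨x, hx⟩
      exact ⟨u, congrArg Subtype.val hu⟩
  · constructor
    · rintro ⟨u, v, h, rfl, rfl⟩
      exact e.map_rel_iff.2 h
    · intro h
      obtain ⟨u, hu⟩ := e.surjective ⟨x, S.left_mem h⟩
      obtain ⟨v, hv⟩ := e.surjective ⟨y, S.right_mem h⟩
      refine ⟨u, v, e.map_rel_iff.1 ?_, congrArg Subtype.val hu, congrArg Subtype.val hv⟩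
      rw [hu, hv]
      exact h

lemma InjHom.bijective_ofIso :
    Function.Bijective fun c : Σ S : {S : K.Subgraph | Nonempty (H.Adj ≃r S.coe.Adj)},
      H.Adj ≃r S.1.coe.Adj => ofIso c.2 := by
  constructor
  · rintro ⟨⟨S, hS⟩, e⟩ ⟨⟨S', hS'⟩, e'⟩ (h : ofIso e = ofIso e')
    obtain rfl : S = S' := (image_ofIso e).symm.trans ((congrArg image h).trans (image_ofIso e'))
    obtain rfl : e = e' := RelIso.ext fun u =>
      Subtype.ext (DFunLike.congr_fun (congrArg Subtype.val h) u)
    rfl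
  · exact fun φ => ⟨⟨⟨φ.image, ⟨φ.isoImage⟩⟩, φ.isoImage⟩, rfl⟩

lemma card_injHom (H : Digraph V) (K : Digraph W) :
    Nat.card (InjHom H K) = H.copyCount K * Nat.card (H.Adj ≃r H.Adj) := by
  rw [← Nat.card_congr (.ofBijective _ InjHom.bijective_ofIso), Digraph.copyCount,
    ← Nat.card_coe_set_eq, ← Nat.card_prod]
  refine Nat.card_congr ((Equiv.sigmaCongrRight fun S => ?_).trans (Equiv.sigmaEquivProd _ _))
  exact
    { toFun := fun e => e.trans S.2.some.symm
      invFun := fun e => e.trans S.2.some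
      left_inv := fun e => by ext; simp
      right_inv := fun e => by ext; simp }

end copies

/-! ### Sign matrices -/

lemma ne_of_adj_of_isOriented {V : Type*} {H : Digraph V} (ho : H.IsOriented) {u v : V}
    (h : H.Adj u v) : u ≠ v := by
  rintro rfl
  exact ho u u h h

section sign

variable {V I R : Type*} [Fintype V] [CommRing R]

/-- The digraph of a matrix of signs: the edges are the entries `1`. -/
def signDigraph (x : I → I → R) : Digraph I := ⟨fun i j => x i j = 1⟩

lemma isTournament_signDigraph [NoZeroDivisors R] [CharZero R] {x : I → I → R}
    (h_skew : ∀ i j, x i j = -x j i) (h_sign : ∀ i j, i ≠ j → x i j = 1 ∨ x i j = -1) :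
    (signDigraph x).IsTournament := by
  have h_one : (1 : R) ≠ -1 := fun h => one_ne_zero (self_eq_neg.1 h)
  refine ⟨fun i (h : x i i = 1) => h_one ?_, fun i j hij => ?_⟩
  · rw [← h, ← h_skew]
  · change x i j = 1 ↔ ¬ x j i = 1
    rw [h_skew j i, neg_eq_iff_eq_neg]
    obtain h | h := h_sign i j hij <;> simp [h, h_one, h_one.symm]

open Classical in
lemma arcProd_eq_ite_of_sign {H : Digraph V} {x : I → I → R} {φ : V → I}
    (h_sign : ∀ u v, H.Adj u v → x (φ u) (φ v) = 1 ∨ x (φ u) (φ v) = -1) :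
    arcProd H x φ = if ∀ u v, H.Adj u v → (signDigraph x).Adj (φ u) (φ v)
      then 2 ^ (arcs H).card else 0 := by
  split_ifs with h
  · refine (Finset.prod_congr rfl fun p hp => ?_).trans (Finset.prod_const 2)
    rw [show x (φ p.1) (φ p.2) = 1 from h _ _ (mem_arcs.1 hp), one_add_one_eq_two]
  · push Not at h
    obtain ⟨u, v, huv, h⟩ := h
    refine Finset.prod_eq_zero (mem_arcs (p := (u, v)).2 huv) ?_
    rw [(h_sign u v huv).resolve_left h, add_neg_cancel]

lemma sum_arcProd_of_sign [Fintype I] {H : Digraph V}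
    (ho : H.IsOriented) {x : I → I → R} (h_sign : ∀ i j, i ≠ j → x i j = 1 ∨ x i j = -1) :
    ∑ φ : V ↪ I, arcProd H x φ =
      2 ^ (arcs H).card * (Nat.card (InjHom H (signDigraph x)) : R) := by
  classical
  have h_ite (φ : V ↪ I) := arcProd_eq_ite_of_sign (H := H) (x := x) (φ := φ) fun u v huv =>
    h_sign _ _ (φ.injective.ne (ne_of_adj_of_isOriented ho huv))
  rw [Finset.sum_congr rfl fun φ _ => h_ite φ, ← Finset.sum_filter, Finset.sum_const,
    Nat.card_eq_fintype_card, Fintype.card_subtype, nsmul_eq_mul, mul_comm]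

section setEntry

variable [DecidableEq I]

/-- The matrix `x` with the entries at `(i, j)` and `(j, i)` replaced by `a` and `-a`. -/
def setEntry (x : I → I → R) (i j : I) (a : R) (k l : I) : R :=
  if k = i ∧ l = j then a else if k = j ∧ l = i then -a else x k l

variable {x : I → I → R} {i j : I}

lemma setEntry_self (a : R) : setEntry x i j a i j = a := by simp [setEntry]

lemma setEntry_swap (hij : i ≠ j) (a : R) : setEntry x i j a j i = -a := by
  simp [setEntry, hij]

lemma setEntry_of_ne {k l : I} (h : s(k, l) ≠ s(i, j)) (a : R) : setEntry x i j a k l = x k l := by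
  rw [Ne, Sym2.eq_iff, not_or] at h
  rw [setEntry, if_neg h.1, if_neg h.2]

lemma setEntry_eq_neg (h_skew : ∀ k l, x k l = -x l k) (hij : i ≠ j) (a : R) (k l : I) :
    setEntry x i j a k l = -setEntry x i j a l k := by
  by_cases h : s(k, l) = s(i, j)
  · obtain ⟨rfl, rfl⟩ | ⟨rfl, rfl⟩ := Sym2.eq_iff.1 h <;>
      simp [setEntry_self, setEntry_swap, hij]
  · rw [setEntry_of_ne h, setEntry_of_ne (Sym2.eq_swap ▸ h), h_skew]

lemma setEntry_eq_self (h_skew : ∀ k l, x k l = -x l k) : setEntry x i j (x i j) = x := by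
  funext k l
  rw [setEntry]
  split_ifs with h h
  · rw [h.1, h.2]
  · rw [h.1, h.2, ← h_skew]
  · rfl

lemma setEntry_eq_one_or_neg_one {a : R} (ha : a = 1 ∨ a = -1) {k l : I} (h : s(k, l) = s(i, j)) :
    setEntry x i j a k l = 1 ∨ setEntry x i j a k l = -1 := by
  rw [setEntry]
  obtain h | h := Sym2.eq_iff.1 h
  · rwa [if_pos h]
  · split_ifs
    · exact ha
    · rwa [neg_eq_iff_eq_neg, neg_inj, or_comm]

lemma arcs_ext {H : Digraph V} (ho : H.IsOriented) {p q : V × V} (hp : p ∈ arcs H)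
    (hq : q ∈ arcs H) (h : s(p.1, p.2) = s(q.1, q.2)) : p = q := by
  obtain h | ⟨h, h'⟩ := Sym2.eq_iff.1 h
  · exact Prod.ext h.1 h.2
  · rw [mem_arcs, h, h'] at hp
    exact absurd hp (ho _ _ (mem_arcs.1 hq))

lemma exists_arcProd_setEntry_eq {H : Digraph V} (ho : H.IsOriented) (x : I → I → R) (hij : i ≠ j)
    (φ : V ↪ I) : ∃ b c, ∀ a, arcProd H (setEntry x i j a) φ = b + c * a := by
  classical
  by_cases h : ∃ p ∈ arcs H, s(φ p.1, φ p.2) = s(i, j)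
  · obtain ⟨p, hp, h_eq⟩ := h
    let P := ∏ q ∈ (arcs H).erase p, (1 + x (φ q.1) (φ q.2))
    have h_rest (a : R) : ∏ q ∈ (arcs H).erase p, (1 + setEntry x i j a (φ q.1) (φ q.2)) = P := by
      refine Finset.prod_congr rfl fun q hq => ?_
      rw [setEntry_of_ne fun hq_eq => Finset.ne_of_mem_erase hq ?_]
      refine arcs_ext ho (Finset.mem_of_mem_erase hq) hp ?_
      exact Sym2.map.injective φ.injective (hq_eq.trans h_eq.symm)
    simp only [arcProd, ← Finset.mul_prod_erase _ _ hp, h_rest]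
    obtain ⟨h₁, h₂⟩ | ⟨h₁, h₂⟩ := Sym2.eq_iff.1 h_eq
    · exact ⟨P, P, fun a => by rw [h₁, h₂, setEntry_self]; ring⟩
    · exact ⟨P, -P, fun a => by rw [h₁, h₂, setEntry_swap hij]; ring⟩
  · push Not at h
    refine ⟨arcProd H x φ, 0, fun a => ?_⟩
    rw [zero_mul, add_zero]
    exact Finset.prod_congr rfl fun p hp => by rw [setEntry_of_ne (h p hp)]

lemma sum_arcProd_setEntry_eq [NoZeroDivisors R] [CharZero R] [Fintype I] {H : Digraph V}
    (ho : H.IsOriented) (x : I → I → R) (hij : i ≠ j) {c : R}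
    (h : ∀ a, a = 1 ∨ a = -1 → ∑ φ : V ↪ I, arcProd H (setEntry x i j a) φ = c) (a : R) :
    ∑ φ : V ↪ I, arcProd H (setEntry x i j a) φ = c := by
  choose b d h_affine using exists_arcProd_setEntry_eq ho x hij
  simp only [h_affine, Finset.sum_add_distrib, ← Finset.sum_mul] at h ⊢
  have h_one := h 1 (.inl rfl)
  have h_neg := h (-1) (.inr rfl)
  have h_slope : 2 * ∑ φ, d φ = 0 := by linear_combination h_one - h_neg
  rw [(mul_eq_zero.1 h_slope).resolve_left two_ne_zero, zero_mul, add_zero] at h_one ⊢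
  exact h_one

end setEntry

lemma sum_arcProd_eq_of_sign [NoZeroDivisors R] [CharZero R] [Fintype I] {H : Digraph V}
    (ho : H.IsOriented) {c : R}
    (h : ∀ x : I → I → R, (∀ i j, x i j = -x j i) → (∀ i j, i ≠ j → x i j = 1 ∨ x i j = -1) →
      ∑ φ : V ↪ I, arcProd H x φ = c)
    {x : I → I → R} (h_skew : ∀ i j, x i j = -x j i) :
    ∑ φ : V ↪ I, arcProd H x φ = c := by
  classical
  suffices h_off : ∀ (P : Finset (Sym2 I)) (x : I → I → R), (∀ i j, x i j = -x j i) →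
      (∀ i j, i ≠ j → s(i, j) ∉ P → x i j = 1 ∨ x i j = -1) → ∑ φ : V ↪ I, arcProd H x φ = c from
    h_off Finset.univ x h_skew fun i j _ h_mem => absurd (Finset.mem_univ _) h_mem
  intro P
  induction P using Finset.induction with
  | empty => exact fun x hx hs => h x hx fun i j hij => hs i j hij (Finset.notMem_empty _)
  | insert e P _ ih =>
    intro x hx hs
    induction e using Sym2.ind with | _ i j
    by_cases hij : i = j
    · refine ih x hx fun k l hkl h_mem => hs k l hkl ?_
      rw [Finset.mem_insert, not_or]
      exact ⟨fun h_eq => hkl (Sym2.mk_isDiag_iff.1 (h_eq ▸ Sym2.mk_isDiag_iff.2 hij)), h_mem⟩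
    · rw [← setEntry_eq_self (i := i) (j := j) hx]
      refine sum_arcProd_setEntry_eq ho x hij (fun a ha => ?_) _
      refine ih _ (setEntry_eq_neg hx hij a) fun k l hkl h_mem => ?_
      by_cases h_eq : s(k, l) = s(i, j)
      · exact setEntry_eq_one_or_neg_one ha h_eq
      · rw [setEntry_of_ne h_eq]
        exact hs k l hkl (by simp [h_eq, h_mem])

end sign

section orderSign

variable (R : Type*) [CommRing R] {I : Type*} [LinearOrder I]

/-- The sign matrix of the transitive tournament of a linear order. -/
def orderSign (i j : I) : R := if i < j then 1 else if j < i then -1 else 0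

lemma orderSign_eq_neg (i j : I) : orderSign R i j = -orderSign R j i := by
  obtain h | rfl | h := lt_trichotomy i j <;> simp [orderSign, *, LT.lt.not_gt]

lemma orderSign_eq_one_or_neg_one (i j : I) (h : i ≠ j) :
    orderSign R i j = 1 ∨ orderSign R i j = -1 := by
  obtain h | h := h.lt_or_gt <;> simp [orderSign, h, h.not_gt]

end orderSign

lemma exists_sum_arcProd_eq (R : Type*) [CommRing R] [NoZeroDivisors R] [CharZero R] {V : Type*}
    [Fintype V] {H : Digraph V} (ho : H.IsOriented) (hi : H.IsImpartial) :
    ∃ n, Fintype.card V ≤ n ∧ ∀ x : Fin n → Fin n → R, (∀ i j, x i j = -x j i) →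
      ∑ φ : V ↪ Fin n, arcProd H x φ = Fintype.card (V ↪ Fin n) := by
  obtain ⟨n, hn, h⟩ := hi
  refine ⟨n, hn, fun x hx => ?_⟩
  let x₀ : Fin n → Fin n → R := orderSign R
  have h_const {y : Fin n → Fin n → R} (hy : ∀ i j, y i j = -y j i) :
      ∑ φ : V ↪ Fin n, arcProd H y φ = ∑ φ : V ↪ Fin n, arcProd H x₀ φ := by
    refine sum_arcProd_eq_of_sign ho (fun z hz hs => ?_) hy
    rw [sum_arcProd_of_sign ho hs, sum_arcProd_of_sign ho (orderSign_eq_one_or_neg_one R),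
      card_injHom, card_injHom, h _ _ (isTournament_signDigraph hz hs)
        (isTournament_signDigraph (orderSign_eq_neg R) (orderSign_eq_one_or_neg_one R))]
  rw [h_const hx, ← h_const (y := 0) (by simp)]
  simp [arcProd]

/-! ### Impartial digraphs -/

section impartial

variable {V R : Type*} [Fintype V] [DecidableEq V] [CommRing R]

lemma sum_prod_comp_eq_pow {X : Type*} [Fintype X] (w : X → R) :
    ∑ χ : V → X, ∏ v, w (χ v) = (∑ x, w x) ^ Fintype.card V := by
  rw [← Fintype.prod_sum fun _ : V => w, Finset.prod_const, Finset.card_univ]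

lemma homSum_bot (K : SkewKernel R) :
    homSum K (⊥ : Digraph V) = (∑ x, K.weight x) ^ Fintype.card V := by
  rw [← sum_prod_comp_eq_pow]
  exact Finset.sum_congr rfl fun χ _ => by rw [arcProd_bot, mul_one]

lemma sum_comp_embedding {I X : Type*} [Fintype I] [DecidableEq I] [Fintype X] (w : X → R)
    (g : (V → X) → R) (φ : V ↪ I) :
    ∑ ψ : I → X, (∏ i, w (ψ i)) * g (ψ ∘ φ) =
      (∑ x, w x) ^ (Fintype.card I - Fintype.card V) * ∑ χ : V → X, (∏ v, w (χ v)) * g χ := by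
  classical
  let J := {i // i ∉ Set.range φ}
  let e : V ⊕ J ≃ I := ((Equiv.ofInjective φ φ.injective).sumCongr (Equiv.refl J)).trans
    (Equiv.Set.sumCompl (Set.range φ))
  let E : (J → X) × (V → X) ≃ (I → X) := (Equiv.prodComm _ _).trans <|
    (Equiv.sumArrowEquivProdArrow V J X).symm.trans (e.arrowCongr (Equiv.refl X))
  have hE (χ : (J → X) × (V → X)) (s : V ⊕ J) : E χ (e s) = Sum.elim χ.2 χ.1 s := by
    simp [E, Equiv.sumArrowEquivProdArrow]
  have h_comp (χ : (J → X) × (V → X)) : E χ ∘ φ = χ.2 := funext fun v => hE χ (.inl v)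
  have h_card : Fintype.card I - Fintype.card V = Fintype.card J := by
    rw [← Fintype.card_congr e, Fintype.card_sum, Nat.add_sub_cancel_left]
  rw [h_card, ← sum_prod_comp_eq_pow, Finset.sum_mul_sum, ← Fintype.sum_prod_type', ← E.sum_comp]
  refine Finset.sum_congr rfl fun χ _ => ?_
  rw [h_comp, ← e.prod_comp]
  simp only [hE, Fintype.prod_sum_type, Sum.elim_inl, Sum.elim_inr]
  ring

lemma exists_pow_mul_homSum_eq (R : Type*) [CommRing R] [NoZeroDivisors R] [CharZero R]
    {H : Digraph V} (ho : H.IsOriented) (hi : H.IsImpartial) :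
    ∃ m : ℕ, ∀ K : SkewKernel R,
      (∑ x, K.weight x) ^ m * homSum K H = (∑ x, K.weight x) ^ (m + Fintype.card V) := by
  obtain ⟨n, hn, h⟩ := exists_sum_arcProd_eq R ho hi
  refine ⟨n - Fintype.card V, fun K => ?_⟩
  have h_card : (Fintype.card (V ↪ Fin n) : R) ≠ 0 := by
    rw [Nat.cast_ne_zero, Fintype.card_embedding_eq, Fintype.card_fin]
    exact (Nat.descFactorial_pos.2 hn).ne'
  refine mul_left_cancel₀ h_card ?_
  calc (Fintype.card (V ↪ Fin n) : R) * ((∑ x, K.weight x) ^ (n - Fintype.card V) * homSum K H)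
      = ∑ φ : V ↪ Fin n, ∑ ψ : Fin n → K.carrier, (∏ i, K.weight (ψ i)) *
          arcProd H (fun i j => K.val (ψ i) (ψ j)) φ := by
        rw [← nsmul_eq_mul, ← Finset.card_univ, ← Finset.sum_const]
        refine Finset.sum_congr rfl fun φ _ => ?_
        have h_sum := sum_comp_embedding K.weight (arcProd H K.val) φ
        rw [Fintype.card_fin] at h_sum
        exact h_sum.symm
    _ = ∑ ψ : Fin n → K.carrier, (∏ i, K.weight (ψ i)) *
          ∑ φ : V ↪ Fin n, arcProd H (fun i j => K.val (ψ i) (ψ j)) φ := by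
        simp only [Finset.mul_sum]
        exact Finset.sum_comm
    _ = ∑ ψ : Fin n → K.carrier, (∏ i, K.weight (ψ i)) * Fintype.card (V ↪ Fin n) :=
        Finset.sum_congr rfl fun ψ _ => by rw [h _ fun i j => K.antisymm _ _]
    _ = Fintype.card (V ↪ Fin n) * (∑ x, K.weight x) ^ (n - Fintype.card V + Fintype.card V) := by
        rw [← Finset.sum_mul, ← Fintype.sum_pow, Nat.sub_add_cancel hn, mul_comm]

lemma eq_of_sum_powerset_eq {α M : Type*} [AddCancelCommMonoid M]
    {f g : Finset α → M} (h : ∀ S : Finset α, ∑ T ∈ S.powerset, f T = ∑ T ∈ S.powerset, g T) :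
    f = g := by
  classical
  funext S
  induction S using Finset.strongInduction with | H S ih
  have h_self := Finset.mem_powerset_self S
  have h_erase : ∑ T ∈ S.powerset.erase S, f T = ∑ T ∈ S.powerset.erase S, g T :=
    Finset.sum_congr rfl fun T hT => ih T <| (Finset.mem_powerset.1
      (Finset.mem_of_mem_erase hT)).ssubset_of_ne (Finset.ne_of_mem_erase hT)
  have h_sum := h S
  rw [← Finset.add_sum_erase _ _ h_self, ← Finset.add_sum_erase _ _ h_self, h_erase] at h_sum
  exact add_right_cancel h_sum

lemma sum_embedding_eq_of_sum_image_subset_eq {I M : Type*} [Fintype I] [DecidableEq I]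
    [AddCancelCommMonoid M] (hI : Fintype.card V = Fintype.card I) {F G : (V → I) → M}
    (h : ∀ S : Finset I, ∑ χ with Finset.univ.image χ ⊆ S, F χ =
      ∑ χ with Finset.univ.image χ ⊆ S, G χ) :
    ∑ φ : V ↪ I, F φ = ∑ φ : V ↪ I, G φ := by
  classical
  have h_powerset (F : (V → I) → M) (S : Finset I) :
      ∑ T ∈ S.powerset, ∑ χ with Finset.univ.image χ = T, F χ =
        ∑ χ with Finset.univ.image χ ⊆ S, F χ := by
    rw [← Finset.sum_fiberwise_of_maps_to (g := fun χ => Finset.univ.image χ)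
      fun χ hχ => Finset.mem_powerset.2 (Finset.mem_filter.1 hχ).2]
    refine Finset.sum_congr rfl fun T hT => Finset.sum_congr ?_ fun _ _ => rfl
    ext χ
    simp only [Finset.mem_filter, Finset.mem_univ, true_and]
    exact ⟨fun h => ⟨h ▸ Finset.mem_powerset.1 hT, h⟩, And.right⟩
  have h_embedding (F : (V → I) → M) :
      ∑ φ : V ↪ I, F φ = ∑ χ with Finset.univ.image χ = Finset.univ, F χ := by
    rw [← Equiv.sum_comp (Equiv.subtypeInjectiveEquivEmbedding V I)]
    refine (Finset.sum_subtype _ (fun χ => ?_) F).symm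
    rw [Finset.mem_filter_univ, ← Finset.coe_eq_univ, Fintype.coe_image_univ, Set.range_eq_univ]
    exact (Finite.injective_iff_surjective_of_equiv (Fintype.equivOfCardEq hI)).symm
  have h_fiber : (fun T => ∑ χ with Finset.univ.image χ = T, F χ) =
      fun T => ∑ χ with Finset.univ.image χ = T, G χ :=
    eq_of_sum_powerset_eq fun S => by rw [h_powerset, h_powerset, h S]
  rw [h_embedding, h_embedding]
  exact congrFun h_fiber Finset.univ

/-- The kernel of the transitive tournament, with weight one on the points of `S`. -/
def orderKernel (R : Type*) [CommRing R] {d : ℕ} (S : Finset (Fin d)) : SkewKernel R where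
  carrier := Fin d
  val := orderSign R
  weight i := if i ∈ S then 1 else 0
  antisymm := orderSign_eq_neg R

lemma sum_weight_orderKernel {d : ℕ} (S : Finset (Fin d)) :
    ∑ i, (orderKernel R S).weight i = S.card := by
  change ∑ i : Fin d, (if i ∈ S then (1 : R) else 0) = S.card
  simp

lemma homSum_orderKernel {d : ℕ} (S : Finset (Fin d)) (H : Digraph V) :
    homSum (orderKernel R S) H =
      ∑ χ : V → Fin d with Finset.univ.image χ ⊆ S, arcProd H (orderSign R) χ := by
  rw [Finset.sum_filter]
  refine Finset.sum_congr rfl fun (χ : V → Fin d) _ => ?_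
  change (∏ u, if χ u ∈ S then (1 : R) else 0) * _ = _
  rw [Finset.prod_boole, boole_mul]
  simp only [Finset.image_subset_iff]
  congr

lemma two_pow_card_arcs_dvd_factorial [Nonempty V] {H : Digraph V} (ho : H.IsOriented) {m : ℕ}
    (h : ∀ K : SkewKernel ℚ,
      (∑ x, K.weight x) ^ m * homSum K H = (∑ x, K.weight x) ^ (m + Fintype.card V)) :
    2 ^ (arcs H).card ∣ (Fintype.card V).factorial := by
  let x : Fin (Fintype.card V) → Fin (Fintype.card V) → ℚ := orderSign ℚ
  have h_subset (S : Finset (Fin (Fintype.card V))) :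
      ∑ χ : V → Fin (Fintype.card V) with Finset.univ.image χ ⊆ S, arcProd H x χ =
        ∑ χ : V → Fin (Fintype.card V) with Finset.univ.image χ ⊆ S, arcProd ⊥ x χ := by
    obtain rfl | hS := S.eq_empty_or_nonempty
    · rw [Finset.filter_false_of_mem fun χ _ => by simp [Finset.univ_nonempty.ne_empty]]
      simp only [Finset.sum_empty]
    · rw [← homSum_orderKernel, ← homSum_orderKernel, homSum_bot]
      refine mul_left_cancel₀ (pow_ne_zero m ?_) ((h _).trans (pow_add _ _ _))
      rw [sum_weight_orderKernel, Nat.cast_ne_zero]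
      exact hS.card_ne_zero
  have h_sum : 2 ^ (arcs H).card * (Nat.card (InjHom H (signDigraph x)) : ℚ) =
      (Fintype.card V).factorial := by
    rw [← sum_arcProd_of_sign ho (orderSign_eq_one_or_neg_one ℚ),
      sum_embedding_eq_of_sum_image_subset_eq (Fintype.card_fin _).symm h_subset]
    simp [arcProd_bot, Fintype.card_embedding_eq, Nat.descFactorial_self]
  exact Dvd.intro _ (by exact_mod_cast h_sum)

end impartial

lemma isTree_of_card_arcs_lt {V : Type*} [Fintype V] {H : Digraph V} (h_conn : H.WeaklyConnected)
    (h : (arcs H).card < Fintype.card V) : H.toSimpleGraphInclusive.IsTree := by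
  classical
  have h_edges : H.toSimpleGraphInclusive.edgeSet ⊆ (arcs H).image fun p => s(p.1, p.2) := by
    intro e he
    induction e using Sym2.ind with | _ u v
    rw [Finset.coe_image]
    obtain ⟨-, h | h⟩ := he
    · exact ⟨(u, v), mem_arcs.2 h, rfl⟩
    · exact ⟨(v, u), mem_arcs.2 h, Sym2.eq_swap⟩
  have h_card : Nat.card H.toSimpleGraphInclusive.edgeSet ≤ (arcs H).card := by
    rw [Nat.card_coe_set_eq]
    refine (Set.ncard_le_ncard h_edges).trans ?_
    rw [Set.ncard_coe_finset]
    exact Finset.card_image_le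
  refine SimpleGraph.isTree_iff_connected_and_card.2 ⟨h_conn, le_antisymm ?_
    h_conn.card_vert_le_card_edgeSet_add_one⟩
  rw [Nat.card_eq_fintype_card (α := V)]
  exact h_card.trans_lt h

theorem proposition5p1 {V : Type*} [Fintype V] (H : Digraph V) (horiented : H.IsOriented)
    (hconn : H.WeaklyConnected) (himp : H.IsImpartial) :
    H.RecursivelyBridgeMirrored := by
  classical
  obtain ⟨m, hm⟩ := exists_pow_mul_homSum_eq ℚ horiented himp
  have : Nonempty V := hconn.nonempty
  have h_arcs : (arcs H).card < Fintype.card V := by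
    have h_dvd := pow_dvd_iff_le_emultiplicity.1 (two_pow_card_arcs_dvd_factorial horiented hm)
    exact_mod_cast h_dvd.trans_lt (Nat.emultiplicity_two_factorial_lt Fintype.card_ne_zero)
  obtain ⟨t, e, -⟩ := exists_iso_of_isTree horiented (isTree_of_card_arcs_lt hconn h_arcs)
    (Classical.arbitrary V)
  have h_universal : formalTotal universalWeight t = universalWeight 1 ^ Fintype.card V := by
    refine formalTotal_universalWeight_eq_pow (m := m) fun K => ?_
    rw [← hm K, ← homSum_congr K e, homSum_toDigraph]
  have h_mirrored : t.Mirrored := mirrored_of_testTotal_eq_one fun N hN =>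
    testTotal_eq_one_of_universal ℤ hN h_universal
  exact .iso _ _ h_mirrored.recursivelyBridgeMirrored ⟨e⟩
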